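/- Let $\mathbb D=\{w\in\mathbb C:|w|<1\}$. A bounded operator $T$ on a complex Hilbert space $\mathcal H$ is in the Cowen–Douglas class $B_n(\mathbb D)$ if, for every $w\in\mathbb D$, $w\in\sigma(T)$, $\dim\ker(T-w)=n$ and $\operatorname{ran}(T-w)=\mathcal H$, and if $\bigvee_{w\in\mathbb D}\ker(T-w)=\mathcal H$. A holomorphic frame over an open set $U\subseteq\mathbb D$ of its eigenvector bundle $\mathcal E_T$ (with fibre $\ker(T-w)$ at $w$) consists of holomorphic functions $\gamma_1,\dots,\gamma_n:U\to\mathcal H$ such that $\gamma_1(w),\dots,\gamma_n(w)$ is a basis of $\ker(T-w)$ for every $w\in U$. The curvature of $\mathcal E_T$ with respect to such a frame is $$\mathcal K_T(w)=-\frac{\partial}{\partial\overline w}\Big(h^{-1}\frac{\partial h}{\partial w}\Big)(w),\qquad h(w)=\big(\langle\gamma_j(w),\gamma_i(w)\rangle\big)_{i,j=1}^n ,$$ where $\langle\cdot,\cdot\rangle$ is linear in the first argument; for $n=1$ it is regarded as a scalar. A bounded operator $T$ is homogeneous if $\varphi(T)$ is unitarily equivalent to $T$ for every linear fractional transformation $\varphi$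 of $\mathbb D$ onto $\mathbb D$ that is analytic on $\sigma(T)$. **Proposition.** Let $\mathcal H_0,\mathcal H_1$ be separable complex Hilbert spaces, let $T_0\in B_1(\mathbb D)$ act on $\mathcal H_0$ and $T_1\in B_1(\mathbb D)$ act on $\mathcal H_1$, and let $S_{0,1}:\mathcal H_1\to\mathcal H_0$ be a non-zero bounded operator with $T_0S_{0,1}=S_{0,1}T_1$. Suppose that $$T=\begin{pmatrix}T_0&S_{0,1}\\0&T_1\end{pmatrix}\quad\text{on }\mathcal H_0\oplus\mathcal H_1$$ is homogeneous. Then near every point of $\mathbb D$ the bundles $\mathcal E_T$, $\mathcal E_{T_0}$, $\mathcal E_{T_1}$ (of ranks $2,1,1$) have holomorphic frames, and $$\operatorname{trace}\mathcal K_T(w)=\mathcal K_{T_0}(w)+\mathcal K_{T_1}(w)\qquad(w\in\mathbb D),$$ whichever holomorphic frames near $w$ are used to compute the three curvatures. -/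

import Mathlib

noncomputable section

namespace CowenDouglas

/-- The eigenspace `ker (T - w)` of a bounded operator. -/
def eigenspace {H : Type*} [NormedAddCommGroup H] [InnerProductSpace ℂ H]
    (T : H →L[ℂ] H) (w : ℂ) : Submodule ℂ H :=
  LinearMap.ker (T - w • ContinuousLinearMap.id ℂ H : H →L[ℂ] H).toLinearMap

/-- The Cowen-Douglas class `B_n(Ω)` of bounded operators on a Hilbert space. -/
structure IsCowenDouglas {H : Type*} [NormedAddCommGroup H] [InnerProductSpace ℂ H]
    (n : ℕ) (Ω : Set ℂ) (T : H →L[ℂ] H) : Prop where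
  subset_spectrum : Ω ⊆ spectrum ℂ T
  rank_ker : ∀ w ∈ Ω, Module.rank ℂ (eigenspace T w) = n
  dense_ker : (⨆ w ∈ Ω, eigenspace T w).topologicalClosure = ⊤
  range_eq : ∀ w ∈ Ω, Function.Surjective (T - w • ContinuousLinearMap.id ℂ H : H →L[ℂ] H)

/-- The operator with block matrix `(T₀, S; 0, T₁)` on the Hilbert space direct sum `H₀ ⊕ H₁`. -/
def blockOp {H₀ H₁ : Type*} [NormedAddCommGroup H₀] [InnerProductSpace ℂ H₀]
    [NormedAddCommGroup H₁] [InnerProductSpace ℂ H₁]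
    (T₀ : H₀ →L[ℂ] H₀) (S : H₁ →L[ℂ] H₀) (T₁ : H₁ →L[ℂ] H₁) :
    WithLp 2 (H₀ × H₁) →L[ℂ] WithLp 2 (H₀ × H₁) :=
  (WithLp.prodContinuousLinearEquiv 2 ℂ H₀ H₁).symm.toContinuousLinearMap ∘L
    ((T₀ ∘L ContinuousLinearMap.fst ℂ H₀ H₁ + S ∘L ContinuousLinearMap.snd ℂ H₀ H₁).prod
      (T₁ ∘L ContinuousLinearMap.snd ℂ H₀ H₁)) ∘L
    (WithLp.prodContinuousLinearEquiv 2 ℂ H₀ H₁).toContinuousLinearMap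

/-- The condition on the blocks under which `(T₀, S; 0, T₁)` belongs to `FB₂(Ω)`. -/
structure IsFB₂ {H₀ H₁ : Type*} [NormedAddCommGroup H₀] [InnerProductSpace ℂ H₀]
    [NormedAddCommGroup H₁] [InnerProductSpace ℂ H₁] (Ω : Set ℂ)
    (T₀ : H₀ →L[ℂ] H₀) (S : H₁ →L[ℂ] H₀) (T₁ : H₁ →L[ℂ] H₁) : Prop where
  left : IsCowenDouglas 1 Ω T₀
  right : IsCowenDouglas 1 Ω T₁
  intertwines : T₀ ∘L S = S ∘L T₁
  ne_zero : S ≠ 0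

/-- The open unit disc. -/
def disc : Set ℂ := Metric.ball 0 1

/-- The linear fractional transformation `z ↦ (p z + q) / (r z + s)` is nondegenerate, has no pole
in the unit disc, and maps the unit disc onto itself. -/
def IsDiscMobius (p q r s : ℂ) : Prop :=
  p * s - q * r ≠ 0 ∧ (∀ z ∈ disc, r * z + s ≠ 0) ∧
    (fun z : ℂ => (p * z + q) / (r * z + s)) '' disc = disc

/-- `φ(T) = (p T + q) (r T + s)⁻¹` for `φ(z) = (p z + q) / (r z + s)`; it is meaningful when `φ` has
no pole on the spectrum of `T`, which makes `r T + s` invertible. -/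
def mobiusApply {H : Type*} [NormedAddCommGroup H] [InnerProductSpace ℂ H]
    (p q r s : ℂ) (T : H →L[ℂ] H) : H →L[ℂ] H :=
  (p • T + q • (1 : H →L[ℂ] H)) * Ring.inverse (r • T + s • (1 : H →L[ℂ] H))

/-- `T` is homogeneous: `φ(T)` is unitarily equivalent to `T` for every linear fractional
transformation `φ` of the unit disc onto itself that is analytic on `σ(T)`. -/
def IsHomogeneous {H : Type*} [NormedAddCommGroup H] [InnerProductSpace ℂ H]
    (T : H →L[ℂ] H) : Prop :=
  ∀ p q r s : ℂ, IsDiscMobius p q r s → (∀ z ∈ spectrum ℂ T, r * z + s ≠ 0) →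
    ∃ U : H ≃ₗᵢ[ℂ] H, ∀ x : H, mobiusApply p q r s T (U x) = U (T x)

/-- `γ` is a holomorphic frame over `U` of the eigenvector bundle `w ↦ ker (T - w)`. -/
structure IsHolomorphicFrame {H : Type*} [NormedAddCommGroup H] [InnerProductSpace ℂ H]
    {n : ℕ} (T : H →L[ℂ] H) (U : Set ℂ) (γ : Fin n → ℂ → H) : Prop where
  holomorphic : ∀ i, DifferentiableOn ℂ (γ i) U
  linearIndependent : ∀ w ∈ U, LinearIndependent ℂ (fun i => γ i w)
  span_eq : ∀ w ∈ U, Submodule.span ℂ (Set.range fun i => γ i w) = eigenspace T w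

/-- The Wirtinger derivative `∂/∂w = (∂/∂x - i ∂/∂y) / 2`. -/
def dW (f : ℂ → ℂ) (w : ℂ) : ℂ :=
  (fderiv ℝ f w 1 - Complex.I * fderiv ℝ f w Complex.I) / 2

/-- The Wirtinger derivative `∂/∂w̄ = (∂/∂x + i ∂/∂y) / 2`. -/
def dWbar (f : ℂ → ℂ) (w : ℂ) : ℂ :=
  (fderiv ℝ f w 1 + Complex.I * fderiv ℝ f w Complex.I) / 2

/-- The Gram matrix `h(w) = (⟨γ_j(w), γ_i(w)⟩)_{i,j}`, where `⟨·,·⟩` is linear in its first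
argument; Mathlib's `inner` is linear in its second argument. -/
def gram {H : Type*} [NormedAddCommGroup H] [InnerProductSpace ℂ H]
    {n : ℕ} (γ : Fin n → ℂ → H) (w : ℂ) : Matrix (Fin n) (Fin n) ℂ :=
  Matrix.of fun i j => inner ℂ (γ i w) (γ j w)

/-- The curvature matrix `K(w) = -∂/∂w̄ (h⁻¹ ∂h/∂w)` with respect to the frame `γ`
(derivatives are taken entrywise). -/
def curvature {H : Type*} [NormedAddCommGroup H] [InnerProductSpace ℂ H]
    {n : ℕ} (γ : Fin n → ℂ → H) (w : ℂ) : Matrix (Fin n) (Fin n) ℂ :=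
  Matrix.of fun i j => -dWbar (fun z =>
    ((gram γ z)⁻¹ * Matrix.of fun k l => dW (fun ζ => gram γ ζ k l) z) i j) w

end CowenDouglas

end

/-!
Write `T` for the block operator, and take local holomorphic eigenvectors `t₀`, `t₁` of `T₀`, `T₁`.
Since `S` intertwines, `S t₁ = f t₀` with `f` holomorphic, and `(t₀, 0)`, `(f t₀', -t₁)` is a
holomorphic frame for `T` (`IsFB₂.isHolomorphicFrame`). The trace of the curvature of a bundle is
`-∂̄∂ log det h`, and the Gram determinant of this frame is
`‖t₀‖² ‖t₁‖² (1 + κ ρ)`, where `κ = (‖t₀‖² ‖t₀'‖² - |⟨t₀, t₀'⟩|²) / ‖t₀‖⁴` is minus the curvature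
of `T₀` and `ρ = ‖S t₁‖² / ‖t₁‖²`. A change of frame multiplies it by `|g|²` with `g` holomorphic
and nonvanishing, to which `∂̄∂ log` is blind. So everything rests on `κ ρ` being constant, which is
`IsFB₂.exists_invariant`.

Constancy comes from homogeneity. The spectrum of `T` lies in the closed disc
(`IsHomogeneous.norm_le_one`), hence for every `a` in the disc there is a unitary `U` with
`(T - a) U = (1 - ā T) U T`. This `U` is diagonal with respect to `H₀ ⊕ H₁` (`IsFB₂.diagonal`): if
`Z`, `Z'` are the lower left entries of `U` and `U⁻¹`, then `S Z S Z'` commutes with `T₀` and is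
itself a commutator with `T₀`, so it acts as `0` on eigenvectors by a Kleinecke-Shirokov
argument (`eq_zero_of_commutator`); as all factors act between eigenlines and `S ≠ 0`, the identity
principle (`IsCowenDouglas.eq_zero_of_eventually`) forces `Z = 0` or `Z' = 0`, and either one
implies the other. The diagonal entries of `U` then carry `t₀(0)`, `t₁(0)` and a solution `x` of
`T₀ x = t₀(0)` to the corresponding data at `a`, up to scalars, and comparing norms shows that `κ`
gets multiplied by `(1 - |a|²)⁻²` and `ρ` by `(1 - |a|²)²`.
-/

namespace CowenDouglas

open Filter Topology ComplexConjugate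

/-! ### Eigenvectors of operators in the Cowen-Douglas class -/

section Eigenvectors

variable {H H' K : Type*} [NormedAddCommGroup H] [InnerProductSpace ℂ H]
  [NormedAddCommGroup H'] [InnerProductSpace ℂ H'] [NormedAddCommGroup K] [InnerProductSpace ℂ K]

theorem mem_eigenspace {T : H →L[ℂ] H} {w : ℂ} {x : H} : x ∈ eigenspace T w ↔ T x = w • x := by
  simp [eigenspace, LinearMap.mem_ker, sub_eq_zero]

theorem mem_disc {w : ℂ} : w ∈ disc ↔ ‖w‖ < 1 := by simp [disc]

theorem isOpen_disc : IsOpen disc := Metric.isOpen_ball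

theorem IsCowenDouglas.exists_ne_zero {Ω : Set ℂ} {T : H →L[ℂ] H} (hT : IsCowenDouglas 1 Ω T)
    {w : ℂ} (hw : w ∈ Ω) : ∃ v : H, T v = w • v ∧ v ≠ 0 := by
  have h1 := hT.rank_ker w hw
  have : Nontrivial (eigenspace T w) := by
    rw [← rank_pos_iff_nontrivial (R := ℂ), h1]; simp
  obtain ⟨v, hv⟩ := exists_ne (0 : eigenspace T w)
  exact ⟨v, mem_eigenspace.1 v.2, by simpa using hv⟩

theorem IsCowenDouglas.exists_smul {Ω : Set ℂ} {T : H →L[ℂ] H} (hT : IsCowenDouglas 1 Ω T)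
    {w : ℂ} (hw : w ∈ Ω) {v x : H} (hv : T v = w • v) (hv0 : v ≠ 0) (hx : T x = w • x) :
    ∃ c : ℂ, x = c • v := by
  have h1 : Module.finrank ℂ (eigenspace T w) = 1 := by
    simp [Module.finrank, hT.rank_ker w hw]
  obtain ⟨c, hc⟩ := (finrank_eq_one_iff_of_nonzero' (⟨v, mem_eigenspace.2 hv⟩ : eigenspace T w)
    (by simpa using hv0)).1 h1 ⟨x, mem_eigenspace.2 hx⟩
  exact ⟨c, by simpa using (congrArg Subtype.val hc).symm⟩

/-- A bounded operator is determined by its values on the eigenvectors of a Cowen-Douglas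
operator, because these span a dense subspace. -/
theorem IsCowenDouglas.ext {n : ℕ} {Ω : Set ℂ} {T : H →L[ℂ] H} (hT : IsCowenDouglas n Ω T)
    {A B : H →L[ℂ] K} (h : ∀ w ∈ Ω, ∀ v, T v = w • v → A v = B v) : A = B := by
  have hle : (⨆ w ∈ Ω, eigenspace T w) ≤ LinearMap.ker ((A - B : H →L[ℂ] K) : H →ₗ[ℂ] K) := by
    refine iSup₂_le fun w hw v hv => ?_
    simpa [sub_eq_zero] using h w hw v (mem_eigenspace.1 hv)
  have hcl := Submodule.topologicalClosure_minimal _ hle (A - B).isClosed_ker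
  rw [hT.dense_ker] at hcl
  ext x
  simpa [sub_eq_zero] using hcl (Submodule.mem_top (x := x))

/-- The right inverse of `f` that takes values in the orthogonal complement of `ker f`. -/
theorem exists_rightInverse [CompleteSpace H] (f : H →L[ℂ] H) (hf : Function.Surjective f) :
    ∃ R : H →L[ℂ] H, ∀ x, f (R x) = x := by
  have : CompleteSpace f.ker := f.isClosed_ker.completeSpace_coe
  let g : (f.kerᗮ : Submodule ℂ H) →L[ℂ] H := f ∘L (f.kerᗮ).subtypeL
  have hg : Function.Bijective g := by
    constructor
    · rw [injective_iff_map_eq_zero]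
      intro x hx
      have h1 : (x : H) ∈ f.ker := hx
      have h2 := x.2
      have := (Submodule.mem_orthogonal _ _).1 h2 _ h1
      simpa using this
    · intro y
      obtain ⟨x, rfl⟩ := hf y
      obtain ⟨a, ha, b, hb, rfl⟩ := f.ker.exists_add_mem_mem_orthogonal x
      refine ⟨⟨b, hb⟩, ?_⟩
      have : f a = 0 := ha
      simp [g, this]
  let e := ContinuousLinearEquiv.ofBijective g (LinearMap.ker_eq_bot.2 hg.1)
    (LinearMap.range_eq_top.2 hg.2)
  refine ⟨(f.kerᗮ).subtypeL ∘L (e.symm : H →L[ℂ] _), fun x => ?_⟩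
  exact e.apply_symm_apply x

/-- Near any point `w₀` of the domain there is a nowhere vanishing holomorphic eigenvector
`w ↦ (1 - (w - w₀) R)⁻¹ v`, where `R` is a right inverse of `T - w₀` and `v ∈ ker (T - w₀)`. -/
theorem IsCowenDouglas.exists_holomorphic_eigenvector [CompleteSpace H] {Ω : Set ℂ}
    {T : H →L[ℂ] H} (hT : IsCowenDouglas 1 Ω T) {w₀ : ℂ} (hw₀ : w₀ ∈ Ω) :
    ∃ r > 0, ∃ t : ℂ → H, DifferentiableOn ℂ t (Metric.ball w₀ r) ∧
      ∀ w ∈ Metric.ball w₀ r, T (t w) = w • t w ∧ t w ≠ 0 := by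
  obtain ⟨v, hv, hv0⟩ := hT.exists_ne_zero hw₀
  obtain ⟨R, hR⟩ := exists_rightInverse _ (hT.range_eq w₀ hw₀)
  let M : ℂ → H →L[ℂ] H := fun w => 1 - (w - w₀) • R
  have hM : Differentiable ℂ M := by fun_prop
  have hopen : IsOpen {w | IsUnit (M w)} := Units.isOpen.preimage hM.continuous
  obtain ⟨r, hr, hball⟩ := Metric.isOpen_iff.1 hopen w₀ (by simp [M])
  have key : ∀ w ∈ Metric.ball w₀ r, M w (Ring.inverse (M w) v) = v := fun w hw => by
    have := Ring.mul_inverse_cancel _ (hball hw)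
    simpa using congrArg (fun A : H →L[ℂ] H => A v) this
  refine ⟨r, hr, fun w => Ring.inverse (M w) v, fun w hw => ?_, fun w hw => ?_⟩
  · have h1 : DifferentiableAt ℂ (fun w => Ring.inverse (M w)) w :=
      (differentiableAt_inverse (hball hw)).comp w (hM w)
    exact (h1.clm_apply (differentiableAt_const v)).differentiableWithinAt
  · have hk := key w hw
    constructor
    · set x := Ring.inverse (M w) v
      have hx : x = v + (w - w₀) • R x := by
        rw [← sub_eq_iff_eq_add]; simpa [M] using hk
      have hRx : T (R x) = x + w₀ • R x := by
        have := hR x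
        simp only [sub_apply, smul_apply, ContinuousLinearMap.id_apply] at this
        rwa [sub_eq_iff_eq_add] at this
      have h2 : T x = w₀ • v + (w - w₀) • (x + w₀ • R x) := by
        conv_lhs => rw [hx]
        rw [map_add, map_smul, hv, hRx]
      have h3 : v = x - (w - w₀) • R x := by rw [eq_sub_iff_add_eq]; exact hx.symm
      change T x = w • x
      rw [h2]
      linear_combination (norm := module) w₀ • h3
    · intro h0
      rw [show Ring.inverse (M w) v = 0 from h0, map_zero] at hk
      exact hv0 hk.symm

/-- Identity principle: a bounded operator that vanishes on the eigenvectors belonging to an open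
set of eigenvalues vanishes. -/
theorem IsCowenDouglas.eq_zero_of_eventually [CompleteSpace H] [CompleteSpace K]
    {T : H →L[ℂ] H} (hT : IsCowenDouglas 1 disc T) (A : H →L[ℂ] K) {w₀ : ℂ} (hw₀ : w₀ ∈ disc)
    (h : ∀ᶠ w in 𝓝 w₀, ∀ v, T v = w • v → A v = 0) : A = 0 := by
  let Z : Set ℂ := {w | ∀ᶠ z in 𝓝 w, ∀ v, T v = z • v → A v = 0}
  have hZo : IsOpen Z := isOpen_setOfPred_eventually_nhds
  have hsub : disc ⊆ Z := by
    refine (convex_ball (0 : ℂ) 1).isPreconnected.subset_of_closure_inter_subset hZo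
      ⟨w₀, hw₀, h⟩ ?_
    rintro w ⟨hwc, hw⟩
    obtain ⟨r, hr, t, htd, ht⟩ := hT.exists_holomorphic_eigenvector hw
    obtain ⟨z, hzZ, hz⟩ := Metric.mem_closure_iff.1 hwc r hr
    rw [dist_comm] at hz
    have han : AnalyticOnNhd ℂ (fun z => A (t z)) (Metric.ball w r) :=
      (A.differentiable.comp_differentiableOn htd).analyticOnNhd Metric.isOpen_ball
    have h0 : (fun z => A (t z)) =ᶠ[𝓝 z] 0 := by
      filter_upwards [hzZ, Metric.isOpen_ball.mem_nhds hz] with y hy hyb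
      exact hy _ (ht y hyb).1
    have hE := han.eqOn_zero_of_preconnected_of_eventuallyEq_zero
      (convex_ball w r).isPreconnected hz h0
    filter_upwards [Metric.ball_mem_nhds w hr, isOpen_disc.mem_nhds hw] with y hyb hyd v hv
    obtain ⟨c, rfl⟩ := hT.exists_smul hyd (ht y hyb).1 (ht y hyb).2 hv
    rw [map_smul, show A (t y) = 0 from hE hyb, smul_zero]
  exact hT.ext fun w hw v hv => (hsub hw).self_of_nhds v hv

/-- Cancellation: if `B` carries eigenvectors of `T` to eigenvectors of `T'`, with a homeomorphism
`σ` of the disc (with inverse `τ`) acting on the eigenvalues, and `A B = 0` with `B ≠ 0`, then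
`A = 0`. -/
theorem IsCowenDouglas.eq_zero_of_comp_eq_zero [CompleteSpace H] [CompleteSpace H']
    [CompleteSpace K]
    {T : H →L[ℂ] H} {T' : H' →L[ℂ] H'} (hT : IsCowenDouglas 1 disc T)
    (hT' : IsCowenDouglas 1 disc T') {σ τ : ℂ → ℂ} (hσ : ∀ w ∈ disc, σ w ∈ disc)
    (hτσ : ∀ w ∈ disc, τ (σ w) = w) (hστ : ∀ w ∈ disc, σ (τ w) = w)
    (hτ : ∀ w ∈ disc, ContinuousAt τ w) {B : H →L[ℂ] H'}
    (hB : ∀ w ∈ disc, ∀ v, T v = w • v → T' (B v) = σ w • B v)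
    {A : H' →L[ℂ] K} (hAB : ∀ v, A (B v) = 0) (hB0 : B ≠ 0) : A = 0 := by
  obtain ⟨w₀, hw₀, v₀, hv₀, hBv₀⟩ : ∃ w ∈ disc, ∃ v, T v = w • v ∧ B v ≠ 0 := by
    by_contra! hcon
    exact hB0 (hT.ext fun w hw v hv => by simpa using hcon w hw v hv)
  obtain ⟨r, hr, t, htd, ht⟩ := hT.exists_holomorphic_eigenvector hw₀
  have hmem := Metric.mem_ball_self (x := w₀) hr
  have hB₀ : B (t w₀) ≠ 0 := by
    obtain ⟨c, rfl⟩ := hT.exists_smul hw₀ (ht w₀ hmem).1 (ht w₀ hmem).2 hv₀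
    intro h; simp [h] at hBv₀
  have hcont : ContinuousAt (fun w => B (t w)) w₀ :=
    B.continuous.continuousAt.comp (htd.continuousOn.continuousAt (Metric.ball_mem_nhds _ hr))
  have hne : ∀ᶠ w in 𝓝 w₀, w ∈ disc ∧ w ∈ Metric.ball w₀ r ∧ B (t w) ≠ 0 := by
    filter_upwards [hcont.eventually_ne hB₀, Metric.ball_mem_nhds w₀ hr,
      isOpen_disc.mem_nhds hw₀] with w h1 h2 h3 using ⟨h3, h2, h1⟩
  have hσw₀ := hσ w₀ hw₀
  have hτt : Tendsto τ (𝓝 (σ w₀)) (𝓝 w₀) := by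
    have := hτ _ hσw₀
    rwa [ContinuousAt, hτσ w₀ hw₀] at this
  refine hT'.eq_zero_of_eventually A hσw₀ ?_
  filter_upwards [hτt.eventually hne, isOpen_disc.mem_nhds hσw₀] with w ⟨h1, h2, h3⟩ hw v hv
  have h4 := hB _ h1 _ (ht _ h2).1
  rw [hστ w hw] at h4
  obtain ⟨c, rfl⟩ := hT'.exists_smul hw h4 h3 hv
  rw [map_smul, hAB, smul_zero]

/-- The Kleinecke-Shirokov argument: if `C = A B - B A` commutes with `A`, then
`(A - w)ⁿ Bⁿ v = n! cⁿ v` for an eigenvector `v` of `A` and `C`. As the left side grows only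
geometrically, `c = 0`. -/
theorem eq_zero_of_commutator {A B C : H →L[ℂ] H} (hC : A * B = B * A + C) (hAC : A * C = C * A)
    {w c : ℂ} {v : H} (hv0 : v ≠ 0) (hAv : A v = w • v) (hCv : C v = c • v) : c = 0 := by
  let a : H →L[ℂ] H := A - w • 1
  have haC : a * C = C * a := by simp [a, sub_mul, mul_sub, hAC]
  have haB : a * B = B * a + C := by
    simp only [a, sub_mul, mul_sub, hC, smul_mul_assoc, one_mul, mul_smul_comm, mul_one]; abel
  have hav : a v = 0 := by simp [a, hAv]
  have hcomm : ∀ n : ℕ, a ^ n * C = C * a ^ n := fun n => (show Commute a C from haC).pow_left n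
  have hpow : ∀ n : ℕ, a ^ (n + 1) * B = B * a ^ (n + 1) + ((n : ℂ) + 1) • (C * a ^ n) := by
    intro n
    induction n with
    | zero => simp [haB]
    | succ n ih =>
      rw [pow_succ' a (n + 1), mul_assoc, ih, mul_add, ← mul_assoc, haB, mul_smul_comm,
        ← mul_assoc, haC, add_mul, mul_assoc, mul_assoc, ← pow_succ', ← pow_succ']
      push_cast
      module
  have hpow' : ∀ (n : ℕ) (x : H),
      (a ^ (n + 1)) (B x) = B ((a ^ (n + 1)) x) + ((n : ℂ) + 1) • C ((a ^ n) x) := fun n x => by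
    simpa using congrArg (fun D : H →L[ℂ] H => D x) (hpow n)
  have key : ∀ n : ℕ, (a ^ n) ((B ^ n) v) = ((n.factorial : ℂ) * c ^ n) • v := by
    intro n
    induction n with
    | zero => simp
    | succ n ih =>
      have h1 : (a ^ (n + 1)) ((B ^ n) v) = 0 := by
        rw [pow_succ', mul_apply_eq_comp, ih, map_smul, hav, smul_zero]
      rw [pow_succ' B, mul_apply_eq_comp, hpow', h1, ih, map_zero, zero_add, map_smul,
        hCv, smul_smul, smul_smul, Nat.factorial_succ]
      congr 1
      push_cast
      ring
  by_contra hc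
  have hbound : ∀ n : ℕ, 1 ≤ (‖a‖ * ‖B‖ / ‖c‖) ^ n / n.factorial := fun n => by
    have h1 : ‖(a ^ n) ((B ^ n) v)‖ ≤ ‖a‖ ^ n * (‖B‖ ^ n * ‖v‖) :=
      calc _ ≤ ‖a ^ n‖ * (‖B ^ n‖ * ‖v‖) :=
            (ContinuousLinearMap.le_opNorm _ _).trans
              (mul_le_mul_of_nonneg_left (ContinuousLinearMap.le_opNorm _ _) (norm_nonneg _))
        _ ≤ _ := by
            have : Nontrivial H := ⟨v, 0, hv0⟩
            gcongr <;> exact norm_pow_le _ n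
    rw [key, norm_smul, norm_mul, norm_pow, Complex.norm_natCast] at h1
    have hv : 0 < ‖v‖ := norm_pos_iff.2 hv0
    have hcp : 0 < ‖c‖ := norm_pos_iff.2 hc
    have hfac : (0 : ℝ) < n.factorial := by positivity
    rw [div_pow, mul_pow, div_div, le_div_iff₀ (by positivity)]
    refine le_of_mul_le_mul_right ?_ hv
    linarith
  have hlim := FloorSemiring.tendsto_pow_div_factorial_atTop (‖a‖ * ‖B‖ / ‖c‖)
  have := ge_of_tendsto' hlim hbound
  norm_num at this

end Eigenvectors

/-! ### Automorphisms of the unit disc -/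

section DiscAutomorphisms

/-- The automorphism `w ↦ (w + a) / (1 + ā w)` of the unit disc, which carries `0` to `a`. -/
noncomputable def discAut (a w : ℂ) : ℂ := (w + a) / (1 + conj a * w)

theorem discAut_denom_ne_zero {a w : ℂ} (ha : ‖a‖ < 1) (hw : ‖w‖ ≤ 1) : 1 + conj a * w ≠ 0 := by
  intro h
  have h1 : conj a * w = -1 := by linear_combination h
  have h2 := congrArg norm h1
  rw [norm_mul, RCLike.norm_conj, norm_neg, norm_one] at h2
  nlinarith [norm_nonneg a, norm_nonneg w]

theorem discAut_mem {a w : ℂ} (ha : a ∈ disc) (hw : w ∈ disc) : discAut a w ∈ disc := by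
  rw [mem_disc] at *
  have hd := discAut_denom_ne_zero ha hw.le
  rw [discAut, norm_div, div_lt_one (norm_pos_iff.2 hd)]
  refine lt_of_pow_lt_pow_left₀ 2 (norm_nonneg _) ?_
  have hkey : ‖1 + conj a * w‖ ^ 2 - ‖w + a‖ ^ 2 = (1 - ‖a‖ ^ 2) * (1 - ‖w‖ ^ 2) := by
    simp only [Complex.sq_norm, Complex.normSq_apply]
    simp
    ring
  have h1 : 0 < 1 - ‖a‖ ^ 2 := by nlinarith [norm_nonneg a]
  have h2 : 0 < 1 - ‖w‖ ^ 2 := by nlinarith [norm_nonneg w]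
  nlinarith [mul_pos h1 h2]

theorem neg_mem_disc {a : ℂ} (ha : a ∈ disc) : -a ∈ disc := by
  rw [mem_disc] at *; simpa using ha

theorem one_sub_conj_mul_ne_zero {a : ℂ} (ha : a ∈ disc) : 1 - conj a * a ≠ 0 := by
  rw [mem_disc] at ha
  have := discAut_denom_ne_zero (a := a) (w := -a) ha (by simpa using ha.le)
  simpa [sub_eq_add_neg] using this

theorem discAut_neg_discAut {a w : ℂ} (ha : a ∈ disc) (hw : w ∈ disc) :
    discAut (-a) (discAut a w) = w := by
  have h1 := discAut_denom_ne_zero (mem_disc.1 ha) (mem_disc.1 hw).le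
  have h2 := discAut_denom_ne_zero (mem_disc.1 (neg_mem_disc ha))
    (mem_disc.1 (discAut_mem ha hw)).le
  have h3 := one_sub_conj_mul_ne_zero ha
  rw [discAut, div_eq_iff h2]
  have h4 : discAut a w * (1 + conj a * w) = w + a := div_mul_cancel₀ _ h1
  rw [map_neg]
  linear_combination h4

theorem discAut_discAut_neg {a w : ℂ} (ha : a ∈ disc) (hw : w ∈ disc) :
    discAut a (discAut (-a) w) = w := by
  simpa using discAut_neg_discAut (neg_mem_disc ha) hw

theorem continuousAt_discAut {a w : ℂ} (ha : a ∈ disc) (hw : w ∈ disc) :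
    ContinuousAt (discAut a) w :=
  ContinuousAt.div (by fun_prop) (by fun_prop)
    (discAut_denom_ne_zero (mem_disc.1 ha) (mem_disc.1 hw).le)

theorem isDiscMobius_of_mem {a : ℂ} (ha : a ∈ disc) : IsDiscMobius 1 (-a) (-conj a) 1 := by
  have hfun : ∀ z : ℂ, (1 * z + -a) / (-conj a * z + 1) = discAut (-a) z := fun z => by
    simp [discAut, add_comm]
  refine ⟨?_, fun z hz => ?_, ?_⟩
  · convert one_sub_conj_mul_ne_zero ha using 1; ring
  · have := discAut_denom_ne_zero (mem_disc.1 (neg_mem_disc ha)) (mem_disc.1 hz).le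
    simpa [add_comm] using this
  · simp only [hfun]
    refine Set.Subset.antisymm ?_ fun w hw => ⟨discAut a w, discAut_mem ha hw,
      discAut_neg_discAut ha hw⟩
    rintro _ ⟨z, hz, rfl⟩
    exact discAut_mem (neg_mem_disc ha) hz

end DiscAutomorphisms

/-! ### Homogeneous operators -/

section Homogeneous

variable {H : Type*} [NormedAddCommGroup H] [InnerProductSpace ℂ H]

/-- `U` intertwines `T` with `(T - a)(1 - ā T)⁻¹`; the equation is multiplied out so that it does
not mention an inverse. -/
def MobiusIntertwines (a : ℂ) (T U : H →L[ℂ] H) : Prop :=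
  ∀ x, T (U x) - a • U x = U (T x) - conj a • T (U (T x))

theorem MobiusIntertwines.map_eigenvector {a w : ℂ} {T U : H →L[ℂ] H}
    (h : MobiusIntertwines a T U) (ha : a ∈ disc) (hw : w ∈ disc) {x : H} (hx : T x = w • x) :
    T (U x) = discAut a w • U x := by
  have h1 := discAut_denom_ne_zero (mem_disc.1 ha) (mem_disc.1 hw).le
  have h2 := h x
  rw [hx, map_smul, map_smul] at h2
  have h3 : (1 + conj a * w) • T (U x) = (w + a) • U x := by
    linear_combination (norm := module) h2
  rw [discAut, div_eq_inv_mul, mul_smul, ← h3, smul_smul, inv_mul_cancel₀ h1, one_smul]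

theorem isUnit_one_sub_smul {T : H →L[ℂ] H} {b : ℂ} (hb : ∀ z ∈ spectrum ℂ T, -b * z + 1 ≠ 0) :
    IsUnit (-b • T + (1 : ℂ) • (1 : H →L[ℂ] H)) := by
  rcases eq_or_ne b 0 with rfl | hb0
  · simp
  have h1 : b⁻¹ ∉ spectrum ℂ T := fun h => hb _ h (by field_simp; ring)
  rw [spectrum.notMem_iff] at h1
  have h2 : -b • T + (1 : ℂ) • (1 : H →L[ℂ] H) = b • (algebraMap ℂ (H →L[ℂ] H) b⁻¹ - T) := by
    rw [Algebra.algebraMap_eq_smul_one, smul_sub, smul_smul, mul_inv_cancel₀ hb0]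
    module
  rw [h2]
  exact h1.smul (Units.mk0 b hb0)

/-- A homogeneous operator is intertwined with its transform by the automorphism `discAut (-a)`, in
both directions, as soon as the pole `1 / ā` lies off the spectrum. -/
theorem IsHomogeneous.exists_intertwines {T : H →L[ℂ] H} (hT : IsHomogeneous T) {a : ℂ}
    (ha : a ∈ disc) (hspec : ∀ z ∈ spectrum ℂ T, -conj a * z + 1 ≠ 0) :
    ∃ U : H ≃ₗᵢ[ℂ] H, MobiusIntertwines a T (U : H →L[ℂ] H) ∧
      MobiusIntertwines (-a) T (U.symm : H →L[ℂ] H) := by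
  obtain ⟨U, hU⟩ := hT 1 (-a) (-conj a) 1 (isDiscMobius_of_mem ha) hspec
  have hM := isUnit_one_sub_smul hspec
  unfold mobiusApply at hU
  set M : H →L[ℂ] H := -conj a • T + (1 : ℂ) • (1 : H →L[ℂ] H) with hMdef
  set N := Ring.inverse M
  set D : H →L[ℂ] H := (1 : ℂ) • T + -a • (1 : H →L[ℂ] H) with hDdef
  have hMN : M * N = 1 := Ring.mul_inverse_cancel _ hM
  have hNM : N * M = 1 := Ring.inverse_mul_cancel _ hM
  have hMD : M * D = D * M := by
    simp only [hMdef, hDdef, mul_add, add_mul, smul_mul_assoc, mul_smul_comm, one_mul, mul_one]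
    module
  have hMDN : M * (D * N) = D := by rw [← mul_assoc, hMD, mul_assoc, hMN, mul_one]
  have hDNM : D * N * M = D := by rw [mul_assoc, hNM, mul_one]
  have hMx : ∀ x, M x = x - conj a • T x := fun x => by simp [hMdef]; abel
  have hDx : ∀ x, D x = T x - a • x := fun x => by simp [hDdef]; abel
  refine ⟨U, fun x => ?_, fun x => ?_⟩
  · have h1 : M ((D * N) (U x)) = D (U x) := congrArg (fun A : H →L[ℂ] H => A (U x)) hMDN
    rw [hU, hMx, hDx] at h1
    exact h1.symm
  · have h1 : (D * N) (M x) = D x := congrArg (fun A : H →L[ℂ] H => A x) hDNM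
    have h2 := hU (U.symm (M x))
    rw [U.apply_symm_apply, h1, hMx, hDx] at h2
    have h3 := congrArg U.symm h2
    rw [U.symm_apply_apply] at h3
    simp only [map_sub, map_smul] at h3
    change T (U.symm x) - (-a) • U.symm x
      = U.symm (T x) - conj (-a) • T (U.symm (T x))
    rw [map_neg]
    linear_combination (norm := module) -h3

/-- The spectrum of a homogeneous operator lies in the closed unit disc: a spectral point `z` of
maximal modulus `r > 1` would be carried by the automorphism with `a = z / (2 r²)` to the spectral
point `z (2 - 1 / r²)`, which is larger. -/
theorem IsHomogeneous.norm_le_one [CompleteSpace H] {T : H →L[ℂ] H} (hT : IsHomogeneous T)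
    {z : ℂ} (hz : z ∈ spectrum ℂ T) : ‖z‖ ≤ 1 := by
  obtain ⟨m, hm, hmax⟩ := (spectrum.isCompact T (𝕜 := ℂ)).exists_isMaxOn ⟨z, hz⟩
    continuous_norm.continuousOn
  refine (hmax hz).trans ?_
  by_contra! hm1
  set r := ‖m‖ with hr
  have hr0 : r ≠ 0 := by positivity
  have hmm : conj m * m = (r : ℂ) ^ 2 := by rw [Complex.conj_mul', hr]
  have hrc : (r : ℂ) ≠ 0 := by exact_mod_cast hr0
  let a : ℂ := m / (2 * r ^ 2)
  have hca : conj a = conj m / (2 * r ^ 2) := by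
    simp [a, Complex.conj_ofNat]
  have hna : ‖a‖ = 1 / (2 * r) := by
    simp only [a, norm_div, norm_mul, norm_pow, Complex.norm_real, Complex.norm_ofNat, ← hr]
    rw [Real.norm_of_nonneg (by positivity)]
    field_simp
  have ha : a ∈ disc := by
    rw [mem_disc, hna, div_lt_one (by positivity)]; linarith
  have hspec : ∀ z ∈ spectrum ℂ T, -conj a * z + 1 ≠ 0 := by
    intro y hy h
    have h1 : conj a * y = 1 := by linear_combination -h
    have h2 := congrArg norm h1
    rw [norm_mul, RCLike.norm_conj, hna, norm_one, one_div, inv_mul_eq_div,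
      div_eq_one_iff_eq (by positivity)] at h2
    have : ‖y‖ ≤ r := hmax hy
    linarith
  obtain ⟨U, hU, -⟩ := hT.exists_intertwines ha hspec
  -- `l` is the image of `m` under the automorphism
  let l : ℂ := m * (2 - 1 / (r : ℂ) ^ 2)
  have hl : l ∉ spectrum ℂ T := by
    intro hl
    have h1 : ‖l‖ ≤ r := hmax hl
    have h2 : (2 - 1 / (r : ℂ) ^ 2) = ((2 - 1 / r ^ 2 : ℝ) : ℂ) := by push_cast; ring
    have h3 : 1 / r ^ 2 < 1 := by
      rw [div_lt_one (by positivity)]; nlinarith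
    rw [show l = m * (2 - 1 / (r : ℂ) ^ 2) from rfl, norm_mul, h2, Complex.norm_real,
      Real.norm_of_nonneg (by linarith), ← hr] at h1
    nlinarith
  have hk : 1 + conj a * l = ((2 - 1 / (2 * r ^ 2) : ℝ) : ℂ) := by
    rw [hca]
    push_cast
    simp only [l]
    field_simp
    linear_combination (2 * (r : ℂ) ^ 2 - 1) * hmm
  have hk0 : 1 + conj a * l ≠ 0 := by
    rw [hk]
    have : 1 / (2 * r ^ 2) < 2 := by
      rw [div_lt_iff₀ (by positivity)]; nlinarith
    exact_mod_cast (sub_pos.2 this).ne'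
  have hkm : (1 + conj a * l) * m = a + l := by
    rw [hk]
    push_cast
    simp only [a, l]
    field_simp
    ring
  have hUu : IsUnit (U : H →L[ℂ] H) :=
    ⟨⟨U, (U.symm : H →L[ℂ] H), by ext x; exact U.apply_symm_apply x,
      by ext x; exact U.symm_apply_apply x⟩, rfl⟩
  have hM := isUnit_one_sub_smul hspec
  rw [spectrum.notMem_iff] at hl
  have hfac : (1 + conj a * l) • ((algebraMap ℂ (H →L[ℂ] H) m - T) * (U : H →L[ℂ] H))
      = (-conj a • T + (1 : ℂ) • (1 : H →L[ℂ] H)) * (U : H →L[ℂ] H)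
        * (algebraMap ℂ (H →L[ℂ] H) l - T) := by
    ext x
    have hx := hU x
    simp only [Algebra.algebraMap_eq_smul_one, smul_apply, mul_apply_eq_comp, sub_apply,
      add_apply, one_apply_eq_self, map_sub, map_smul]
    rw [smul_sub, smul_smul, hkm]
    linear_combination (norm := module) -hx
  have hunit := (hM.mul hUu).mul hl
  rw [← hfac] at hunit
  have h1 := hunit.smul (Units.mk0 _ (inv_ne_zero hk0))
  rw [Units.smul_mk0, smul_smul, inv_mul_cancel₀ hk0, one_smul] at h1
  exact hm (hUu.mul_right_iff.1 h1)

end Homogeneous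

/-! ### Rigidity of the flag `H₀ ⊆ H₀ ⊕ H₁` -/

section Blocks

theorem ext_prod {α β : Type*} {x y : WithLp 2 (α × β)} (h₀ : x.fst = y.fst)
    (h₁ : x.snd = y.snd) : x = y :=
  WithLp.ofLp_injective 2 (Prod.ext h₀ h₁)

variable {H₀ H₁ : Type*} [NormedAddCommGroup H₀] [InnerProductSpace ℂ H₀]
  [NormedAddCommGroup H₁] [InnerProductSpace ℂ H₁]

theorem blockOp_fst (T₀ : H₀ →L[ℂ] H₀) (S : H₁ →L[ℂ] H₀) (T₁ : H₁ →L[ℂ] H₁)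
    (x : WithLp 2 (H₀ × H₁)) : (blockOp T₀ S T₁ x).fst = T₀ x.fst + S x.snd := rfl

theorem blockOp_snd (T₀ : H₀ →L[ℂ] H₀) (S : H₁ →L[ℂ] H₀) (T₁ : H₁ →L[ℂ] H₁)
    (x : WithLp 2 (H₀ × H₁)) : (blockOp T₀ S T₁ x).snd = T₁ x.snd := rfl

/-- The isometric embedding of the first summand of `H₀ ⊕ H₁`. -/
def inlL : H₀ →L[ℂ] WithLp 2 (H₀ × H₁) :=
  (WithLp.prodContinuousLinearEquiv 2 ℂ H₀ H₁).symm.toContinuousLinearMap ∘L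
    ContinuousLinearMap.inl ℂ H₀ H₁

/-- The isometric embedding of the second summand of `H₀ ⊕ H₁`. -/
def inrL : H₁ →L[ℂ] WithLp 2 (H₀ × H₁) :=
  (WithLp.prodContinuousLinearEquiv 2 ℂ H₀ H₁).symm.toContinuousLinearMap ∘L
    ContinuousLinearMap.inr ℂ H₀ H₁

@[simp] theorem inlL_fst (x : H₀) : (inlL x : WithLp 2 (H₀ × H₁)).fst = x := rfl
@[simp] theorem inlL_snd (x : H₀) : (inlL x : WithLp 2 (H₀ × H₁)).snd = 0 := rfl
@[simp] theorem inrL_fst (y : H₁) : (inrL y : WithLp 2 (H₀ × H₁)).fst = 0 := rfl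
@[simp] theorem inrL_snd (y : H₁) : (inrL y : WithLp 2 (H₀ × H₁)).snd = y := rfl

theorem inner_inlL (x y : H₀) :
    inner ℂ (inlL x : WithLp 2 (H₀ × H₁)) (inlL y) = inner ℂ x y := by
  simp [WithLp.prod_inner_apply, inlL]

theorem norm_inlL (x : H₀) : ‖(inlL x : WithLp 2 (H₀ × H₁))‖ = ‖x‖ := WithLp.norm_toLp_fst 2 _ _ x

theorem norm_inrL (y : H₁) : ‖(inrL y : WithLp 2 (H₀ × H₁))‖ = ‖y‖ := WithLp.norm_toLp_snd 2 _ _ y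

/-- The upper left entry of the block matrix of `U`. -/
def upperLeft (U : WithLp 2 (H₀ × H₁) →L[ℂ] WithLp 2 (H₀ × H₁)) : H₀ →L[ℂ] H₀ :=
  WithLp.fstL 2 ℂ H₀ H₁ ∘L U ∘L inlL

/-- The lower left entry of the block matrix of `U`. -/
def lowerLeft (U : WithLp 2 (H₀ × H₁) →L[ℂ] WithLp 2 (H₀ × H₁)) : H₀ →L[ℂ] H₁ :=
  WithLp.sndL 2 ℂ H₀ H₁ ∘L U ∘L inlL

theorem upperLeft_apply (U : WithLp 2 (H₀ × H₁) →L[ℂ] WithLp 2 (H₀ × H₁)) (x : H₀) :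
    upperLeft U x = (U (inlL x)).fst := rfl

theorem lowerLeft_apply (U : WithLp 2 (H₀ × H₁) →L[ℂ] WithLp 2 (H₀ × H₁)) (x : H₀) :
    lowerLeft U x = (U (inlL x)).snd := rfl

variable {T₀ : H₀ →L[ℂ] H₀} {S : H₁ →L[ℂ] H₀} {T₁ : H₁ →L[ℂ] H₁}

theorem blockOp_inlL {w : ℂ} {v : H₀} (hv : T₀ v = w • v) :
    blockOp T₀ S T₁ (inlL v) = w • inlL v :=
  ext_prod (by simp [blockOp_fst, hv]) (by simp [blockOp_snd])

theorem IsFB₂.map_eigenvector {Ω : Set ℂ} (hT : IsFB₂ Ω T₀ S T₁) {w : ℂ} {u : H₁}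
    (hu : T₁ u = w • u) : T₀ (S u) = w • S u := by
  have := congrArg (fun A : H₁ →L[ℂ] H₀ => A u) hT.intertwines
  simpa [hu] using this

theorem MobiusIntertwines.lowerLeft_eigenvector {a w : ℂ}
    {U : WithLp 2 (H₀ × H₁) →L[ℂ] WithLp 2 (H₀ × H₁)}
    (h : MobiusIntertwines a (blockOp T₀ S T₁) U) (ha : a ∈ disc) (hw : w ∈ disc) {v : H₀}
    (hv : T₀ v = w • v) : T₁ (lowerLeft U v) = discAut a w • lowerLeft U v := by
  have := congrArg WithLp.snd (h.map_eigenvector ha hw (blockOp_inlL hv))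
  simpa [blockOp_snd, lowerLeft_apply] using this

theorem MobiusIntertwines.upperLeft_eigenvector {a w : ℂ}
    {U : WithLp 2 (H₀ × H₁) →L[ℂ] WithLp 2 (H₀ × H₁)}
    (h : MobiusIntertwines a (blockOp T₀ S T₁) U) (ha : a ∈ disc) (hw : w ∈ disc) {v : H₀}
    (hv : T₀ v = w • v) :
    T₀ (upperLeft U v) + S (lowerLeft U v) = discAut a w • upperLeft U v := by
  have := congrArg WithLp.fst (h.map_eigenvector ha hw (blockOp_inlL hv))
  simpa [blockOp_fst, lowerLeft_apply, upperLeft_apply] using this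

/-- If `U` maps `H₀` into itself, so does its inverse `V`: the eigenspaces of `T₀` are lines, which
`U` permutes. -/
theorem IsFB₂.lowerLeft_inverse_eq_zero {a : ℂ} (hT : IsFB₂ disc T₀ S T₁) (ha : a ∈ disc)
    {U V : WithLp 2 (H₀ × H₁) →L[ℂ] WithLp 2 (H₀ × H₁)}
    (hU : MobiusIntertwines a (blockOp T₀ S T₁) U) (hVU : ∀ x, V (U x) = x)
    (h : lowerLeft U = 0) : lowerLeft V = 0 := by
  have ha' := neg_mem_disc ha
  refine hT.left.ext fun w hw v hv => ?_
  obtain ⟨u, hu, hu0⟩ := hT.left.exists_ne_zero (discAut_mem ha' hw)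
  have hl : lowerLeft U u = 0 := by rw [h, zero_apply]
  have h1 := hU.upperLeft_eigenvector ha (discAut_mem ha' hw) hu
  rw [discAut_discAut_neg ha hw, hl, map_zero, add_zero] at h1
  have h2 : U (inlL u) = inlL (upperLeft U u) := ext_prod rfl hl
  have h3 : upperLeft U u ≠ 0 := by
    intro h0
    rw [h0, map_zero] at h2
    have := hVU (inlL u)
    rw [h2, map_zero] at this
    exact hu0 (congrArg WithLp.fst this).symm
  obtain ⟨c, rfl⟩ := hT.left.exists_smul hw h1 h3 hv
  rw [map_smul, lowerLeft_apply, ← h2, hVU]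
  simp

variable [CompleteSpace H₀] [CompleteSpace H₁]

/-- With `Z` the lower left entry of `U` and `Z'` that of `V`, the operator `S Z S Z'` commutes with
`T₀` and is the commutator of `T₀` with a bounded operator. By the Kleinecke-Shirokov argument it
kills every eigenvector, hence vanishes, and cancellation leaves `Z = 0` or `Z' = 0`. -/
theorem IsFB₂.lowerLeft_eq_zero_or {a : ℂ} (hT : IsFB₂ disc T₀ S T₁) (ha : a ∈ disc)
    {U V : WithLp 2 (H₀ × H₁) →L[ℂ] WithLp 2 (H₀ × H₁)}
    (hU : MobiusIntertwines a (blockOp T₀ S T₁) U)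
    (hV : MobiusIntertwines (-a) (blockOp T₀ S T₁) V) : lowerLeft U = 0 ∨ lowerLeft V = 0 := by
  have ha' := neg_mem_disc ha
  let B : H₀ →L[ℂ] H₀ := upperLeft U ∘L S ∘L lowerLeft V
  let C : H₀ →L[ℂ] H₀ := -(S ∘L lowerLeft U ∘L S ∘L lowerLeft V)
  have hSV : ∀ w ∈ disc, ∀ v, T₀ v = w • v →
      T₀ (S (lowerLeft V v)) = discAut (-a) w • S (lowerLeft V v) := fun w hw v hv =>
    hT.map_eigenvector (hV.lowerLeft_eigenvector ha' hw hv)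
  have hCe : ∀ w ∈ disc, ∀ v, T₀ v = w • v → T₀ (C v) = w • C v := by
    intro w hw v hv
    have h1 := hU.lowerLeft_eigenvector ha (discAut_mem ha' hw) (hSV w hw v hv)
    rw [discAut_discAut_neg ha hw] at h1
    have h2 := hT.map_eigenvector h1
    simp [C, h2]
  have hcomm : T₀ * B = B * T₀ + C := by
    refine hT.left.ext fun w hw v hv => ?_
    have h1 := hU.upperLeft_eigenvector ha (discAut_mem ha' hw) (hSV w hw v hv)
    rw [discAut_discAut_neg ha hw] at h1
    simp only [mul_apply_eq_comp, add_apply, hv, map_smul]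
    simp only [B, C, neg_apply, ContinuousLinearMap.comp_apply]
    linear_combination (norm := module) h1
  have hTC : T₀ * C = C * T₀ := by
    refine hT.left.ext fun w hw v hv => ?_
    simp [hv, hCe w hw v hv]
  have hC0 : C = 0 := by
    refine hT.left.ext fun w hw v hv => ?_
    rcases eq_or_ne v 0 with rfl | hv0
    · simp
    obtain ⟨c, hc⟩ := hT.left.exists_smul hw hv hv0 (hCe w hw v hv)
    rw [hc, eq_zero_of_commutator hcomm hTC hv0 hv hc, zero_smul, zero_apply]
  have hzero : ∀ v, (S ∘L lowerLeft U ∘L S) (lowerLeft V v) = 0 := fun v => by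
    have := congrArg (fun A : H₀ →L[ℂ] H₀ => A v) hC0
    simpa [C] using this
  refine or_iff_not_imp_right.2 fun hV0 => ?_
  have h1 : S ∘L lowerLeft U ∘L S = 0 :=
    hT.left.eq_zero_of_comp_eq_zero hT.right (fun w hw => discAut_mem ha' hw)
      (fun w hw => discAut_discAut_neg ha hw) (fun w hw => discAut_neg_discAut ha hw)
      (fun w hw => continuousAt_discAut ha hw)
      (fun w hw v hv => hV.lowerLeft_eigenvector ha' hw hv) hzero hV0
  have h2 : S ∘L lowerLeft U = 0 :=
    hT.right.eq_zero_of_comp_eq_zero hT.left (σ := id) (τ := id) (fun w hw => hw)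
      (fun w _ => rfl) (fun w _ => rfl) (fun w _ => continuousAt_id)
      (fun w _ v hv => hT.map_eigenvector hv)
      (fun v => congrArg (fun A : H₁ →L[ℂ] H₀ => A v) h1) hT.ne_zero
  by_contra hU0
  exact hT.ne_zero <| hT.left.eq_zero_of_comp_eq_zero hT.right (fun w hw => discAut_mem ha hw)
      (fun w hw => discAut_neg_discAut ha hw) (fun w hw => discAut_discAut_neg ha hw)
      (fun w hw => continuousAt_discAut ha' hw)
      (fun w hw v hv => hU.lowerLeft_eigenvector ha hw hv)
      (fun v => congrArg (fun A : H₀ →L[ℂ] H₀ => A v) h2) hU0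

/-- Rigidity: a unitary operator that intertwines `T` with a Möbius transform of `T` is diagonal
with respect to `H₀ ⊕ H₁`. -/
theorem IsFB₂.diagonal {a : ℂ} (hT : IsFB₂ disc T₀ S T₁) (ha : a ∈ disc)
    {U : WithLp 2 (H₀ × H₁) ≃ₗᵢ[ℂ] WithLp 2 (H₀ × H₁)}
    (hU : MobiusIntertwines a (blockOp T₀ S T₁)
      (U : WithLp 2 (H₀ × H₁) →L[ℂ] WithLp 2 (H₀ × H₁)))
    (hV : MobiusIntertwines (-a) (blockOp T₀ S T₁)
      (U.symm : WithLp 2 (H₀ × H₁) →L[ℂ] WithLp 2 (H₀ × H₁))) :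
    (∀ x : H₀, (U (inlL x)).snd = 0) ∧ ∀ y : H₁, (U (inrL y)).fst = 0 := by
  have hboth : lowerLeft (U : WithLp 2 (H₀ × H₁) →L[ℂ] WithLp 2 (H₀ × H₁)) = 0 ∧
      lowerLeft (U.symm : WithLp 2 (H₀ × H₁) →L[ℂ] WithLp 2 (H₀ × H₁)) = 0 := by
    rcases hT.lowerLeft_eq_zero_or ha hU hV with h | h
    · exact ⟨h, hT.lowerLeft_inverse_eq_zero ha hU (fun x => U.symm_apply_apply x) h⟩
    · exact ⟨hT.lowerLeft_inverse_eq_zero (neg_mem_disc ha) hV (fun x => U.apply_symm_apply x) h,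
        h⟩
  refine ⟨fun x => congrArg (fun A : H₀ →L[ℂ] H₁ => A x) hboth.1, fun y => ?_⟩
  set x := (U (inrL y)).fst
  have h1 : (U.symm (inlL x)).snd = 0 := congrArg (fun A : H₀ →L[ℂ] H₁ => A x) hboth.2
  have h2 : inner ℂ (inlL x) (U (inrL y)) = inner ℂ (U.symm (inlL x)) (inrL y) := by
    rw [← U.inner_map_map (U.symm (inlL x)), U.apply_symm_apply]
  rw [WithLp.prod_inner_apply, WithLp.prod_inner_apply] at h2
  change inner ℂ x x + inner ℂ (0 : H₁) _ = inner ℂ _ (0 : H₀) + inner ℂ (U.symm (inlL x)).snd y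
    at h2
  rw [h1, inner_zero_left, inner_zero_left, inner_zero_right, add_zero, add_zero] at h2
  exact inner_self_eq_zero.1 h2

end Blocks

/-! ### The Möbius invariant of a homogeneous block operator -/

section Invariant

variable {H₀ H₁ : Type*} [NormedAddCommGroup H₀] [InnerProductSpace ℂ H₀] [CompleteSpace H₀]
  [NormedAddCommGroup H₁] [InnerProductSpace ℂ H₁] [CompleteSpace H₁]
  {T₀ : H₀ →L[ℂ] H₀} {S : H₁ →L[ℂ] H₀} {T₁ : H₁ →L[ℂ] H₁}

/-- For `(T₀ - a) x = v` with `v ∈ ker (T₀ - a)`, the quotient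
`(‖v‖² ‖x‖² - |⟨v, x⟩|²) / ‖v‖⁴` is minus the curvature of `T₀` at `a`, and `‖S u‖² / ‖u‖²`, for
`u ∈ ker (T₁ - a)`, measures the second fundamental form. Under a disc automorphism these are
multiplied by inverse factors, so that their product is constant when `T` is homogeneous. -/
theorem IsFB₂.exists_invariant (hT : IsFB₂ disc T₀ S T₁) (hhom : IsHomogeneous (blockOp T₀ S T₁)) :
    ∃ c : ℝ, 0 ≤ c ∧ ∀ a ∈ disc, ∀ (v x : H₀) (u : H₁), T₀ v = a • v → T₀ x = a • x + v →
      T₁ u = a • u →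
      (‖v‖ ^ 2 * ‖x‖ ^ 2 - ‖(inner ℂ v x : ℂ)‖ ^ 2) * ‖S u‖ ^ 2 = c * ‖v‖ ^ 4 * ‖u‖ ^ 2 := by
  have h0 : (0 : ℂ) ∈ disc := by simp [disc]
  obtain ⟨v₀, hv₀, hv₀0⟩ := hT.left.exists_ne_zero h0
  obtain ⟨u₀, hu₀, hu₀0⟩ := hT.right.exists_ne_zero h0
  obtain ⟨x₁, hx₁⟩ := hT.left.range_eq 0 h0 v₀
  rw [zero_smul] at hv₀ hu₀
  rw [zero_smul, sub_zero] at hx₁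
  have hv₀n : ‖v₀‖ ≠ 0 := norm_ne_zero_iff.2 hv₀0
  have hu₀n : ‖u₀‖ ≠ 0 := norm_ne_zero_iff.2 hu₀0
  -- subtract the component along `v₀`
  obtain ⟨x₀, hx₀, hperp⟩ : ∃ x₀, T₀ x₀ = v₀ ∧ inner ℂ v₀ x₀ = 0 := by
    refine ⟨x₁ - (inner ℂ v₀ x₁ / inner ℂ v₀ v₀ : ℂ) • v₀, by simp [hv₀, hx₁], ?_⟩
    rw [inner_sub_right, inner_smul_right, div_mul_cancel₀ _ (inner_self_ne_zero.2 hv₀0), sub_self]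
  refine ⟨‖x₀‖ ^ 2 * ‖S u₀‖ ^ 2 / (‖v₀‖ ^ 2 * ‖u₀‖ ^ 2), by positivity, ?_⟩
  intro a ha v x u hv hx hu
  obtain ⟨U, hU, hV⟩ := hhom.exists_intertwines ha fun z hz => by
    have := discAut_denom_ne_zero (a := -a) (by simpa using mem_disc.1 ha) (hhom.norm_le_one hz)
    simpa [add_comm] using this
  obtain ⟨hd₀, hd₁⟩ := hT.diagonal ha hU hV
  -- the diagonal entries `P`, `Q` of `U` carry the data at `0` to data at `a`
  set P : H₀ → H₀ := fun y => (U (inlL y)).fst with hP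
  set Q : H₁ → H₁ := fun y => (U (inrL y)).snd with hQ
  have hUP : ∀ y, U (inlL y) = inlL (P y) := fun y => ext_prod rfl (hd₀ y)
  have hUQ : ∀ y, U (inrL y) = inrL (Q y) := fun y => ext_prod (hd₁ y) rfl
  have hPn : ∀ y, ‖P y‖ = ‖y‖ := fun y => by
    rw [← norm_inlL (H₁ := H₁) (P y), ← hUP, U.norm_map, norm_inlL]
  have hQn : ∀ y, ‖Q y‖ = ‖y‖ := fun y => by
    rw [← norm_inrL (H₀ := H₀) (Q y), ← hUQ, U.norm_map, norm_inrL]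
  have hTl : ∀ y, blockOp T₀ S T₁ (inlL y) = inlL (T₀ y) := fun y =>
    ext_prod (by simp [blockOp_fst]) (by simp [blockOp_snd])
  have hPT : ∀ y, T₀ (P y) - a • P y = P (T₀ y) - conj a • T₀ (P (T₀ y)) := fun y => by
    have h1 : blockOp T₀ S T₁ (U (inlL y)) - a • U (inlL y) = U (blockOp T₀ S T₁ (inlL y))
      - conj a • blockOp T₀ S T₁ (U (blockOp T₀ S T₁ (inlL y))) := hU (inlL y)
    simp only [hUP, hTl] at h1
    simpa using congrArg WithLp.fst h1
  have hP0 : P 0 = 0 := by simp [hP]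
  have hker : ∀ y, T₀ y = 0 → T₀ (P y) = a • P y := fun y hy => by
    have := hPT y
    rwa [hy, hP0, map_zero, smul_zero, sub_zero, sub_eq_zero] at this
  set k : ℂ := 1 - conj a * a
  have hk : k ≠ 0 := one_sub_conj_mul_ne_zero ha
  have hSu₀ : T₀ (S u₀) = 0 := by
    have := hT.map_eigenvector (w := 0) (u := u₀) (by simpa using hu₀)
    simpa using this
  have hTr : blockOp T₀ S T₁ (inrL u₀) = inlL (S u₀) :=
    ext_prod (by simp [blockOp_fst]) (by simp [blockOp_snd, hu₀])
  have hr := hU (inrL u₀)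
  change blockOp T₀ S T₁ (U (inrL u₀)) - a • U (inrL u₀) = U (blockOp T₀ S T₁ (inrL u₀))
      - conj a • blockOp T₀ S T₁ (U (blockOp T₀ S T₁ (inrL u₀))) at hr
  rw [hTr, hUP, hUQ, hTl] at hr
  have hSQ : S (Q u₀) = k • P (S u₀) := by
    have h1 := congrArg WithLp.fst hr
    simp only [WithLp.sub_fst, WithLp.smul_fst, blockOp_fst, inrL_fst, inrL_snd, inlL_fst, map_zero,
      zero_add, smul_zero, sub_zero, hker _ hSu₀] at h1
    rw [h1]
    module
  have hTQ : T₁ (Q u₀) = a • Q u₀ := by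
    have h1 := congrArg WithLp.snd hr
    simp only [WithLp.sub_snd, WithLp.smul_snd, blockOp_snd, inrL_snd, inlL_snd, smul_zero,
      sub_zero] at h1
    exact sub_eq_zero.1 h1
  have hPx₀ : T₀ (P x₀) = a • P x₀ + k • P v₀ := by
    have := hPT x₀
    rw [hx₀, hker _ hv₀] at this
    linear_combination (norm := module) this
  have hPperp : inner ℂ (P v₀) (P x₀) = 0 := by
    rw [← inner_inlL (H₁ := H₁), ← hUP, ← hUP, U.inner_map_map, inner_inlL, hperp]
  have hPv0 : P v₀ ≠ 0 := by rw [← norm_ne_zero_iff, hPn]; exact hv₀n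
  have hQu0 : Q u₀ ≠ 0 := by rw [← norm_ne_zero_iff, hQn]; exact hu₀n
  -- arbitrary data at `a` differ from these by scalars and by a multiple of `P v₀` added to `x`
  obtain ⟨l, rfl⟩ := hT.left.exists_smul ha (hker _ hv₀) hPv0 hv
  obtain ⟨m, rfl⟩ := hT.right.exists_smul ha hTQ hQu0 hu
  obtain ⟨n, hn⟩ := hT.left.exists_smul ha (hker _ hv₀) hPv0 (x := x - (l / k) • P x₀) (by
    have : l = l / k * k := (div_mul_cancel₀ _ hk).symm
    rw [map_sub, map_smul, hx, hPx₀, smul_sub, smul_add, smul_smul (l / k) k, ← this]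
    module)
  obtain rfl : x = (l / k) • P x₀ + n • P v₀ := by rw [← hn]; abel
  have hinner : (inner ℂ (l • P v₀) ((l / k) • P x₀ + n • P v₀) : ℂ)
      = conj l * n * (‖v₀‖ : ℂ) ^ 2 := by
    rw [inner_add_right, inner_smul_left, inner_smul_left, inner_smul_right, inner_smul_right,
      hPperp, inner_self_eq_norm_sq_to_K, hPn]
    simp
    ring
  have hperp' : inner ℂ (P x₀) (P v₀) = 0 := inner_eq_zero_symm.1 hPperp
  have hnorm : ‖(l / k) • P x₀ + n • P v₀‖ ^ 2
      = (‖l‖ / ‖k‖) ^ 2 * ‖x₀‖ ^ 2 + ‖n‖ ^ 2 * ‖v₀‖ ^ 2 := by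
    rw [norm_add_sq (𝕜 := ℂ), inner_smul_left, inner_smul_right, hperp', norm_smul, norm_smul, hPn,
      hPn, norm_div]
    simp
    ring
  have hkn : ‖k‖ ≠ 0 := norm_ne_zero_iff.2 hk
  rw [hinner, hnorm, map_smul, hSQ]
  simp only [norm_smul, norm_mul, norm_pow, RCLike.norm_conj, Complex.norm_real, norm_norm, hPn,
    hQn]
  field_simp
  ring

end Invariant

/-! ### Wirtinger calculus -/

section Wirtinger

variable {E : Type*} [NormedAddCommGroup E] [InnerProductSpace ℂ E]

theorem dW_congr {f g : ℂ → ℂ} {w : ℂ} (h : f =ᶠ[𝓝 w] g) : dW f w = dW g w := by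
  rw [dW, dW, h.fderiv_eq]

theorem dWbar_congr {f g : ℂ → ℂ} {w : ℂ} (h : f =ᶠ[𝓝 w] g) : dWbar f w = dWbar g w := by
  rw [dWbar, dWbar, h.fderiv_eq]

theorem dW_mul {f g : ℂ → ℂ} {w : ℂ} (hf : DifferentiableAt ℝ f w) (hg : DifferentiableAt ℝ g w) :
    dW (fun z => f z * g z) w = dW f w * g w + f w * dW g w := by
  simp only [dW]
  rw [fderiv_fun_mul hf hg]
  simp
  ring

theorem dW_sub {f g : ℂ → ℂ} {w : ℂ} (hf : DifferentiableAt ℝ f w) (hg : DifferentiableAt ℝ g w) :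
    dW (fun z => f z - g z) w = dW f w - dW g w := by
  simp only [dW]
  rw [fderiv_fun_sub hf hg]
  simp
  ring

theorem dWbar_add {f g : ℂ → ℂ} {w : ℂ} (hf : DifferentiableAt ℝ f w)
    (hg : DifferentiableAt ℝ g w) : dWbar (fun z => f z + g z) w = dWbar f w + dWbar g w := by
  simp only [dWbar]
  rw [fderiv_fun_add hf hg]
  simp
  ring

theorem dWbar_eq_zero {f : ℂ → ℂ} {w : ℂ} (hf : DifferentiableAt ℂ f w) : dWbar f w = 0 := by
  rw [dWbar, (hf.hasDerivAt.hasFDerivAt.restrictScalars ℝ).fderiv]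
  simp [← mul_assoc]

theorem differentiableAt_inner {f k : ℂ → E} {w : ℂ} (hf : DifferentiableAt ℂ f w)
    (hk : DifferentiableAt ℂ k w) : DifferentiableAt ℝ (fun z => inner ℂ (f z) (k z)) w :=
  (hf.restrictScalars ℝ).inner ℂ (hk.restrictScalars ℝ)

theorem dW_inner {f k : ℂ → E} {w : ℂ} (hf : DifferentiableAt ℂ f w)
    (hk : DifferentiableAt ℂ k w) :
    dW (fun z => inner ℂ (f z) (k z)) w = inner ℂ (f w) (deriv k w) := by
  have h := (hf.hasDerivAt.hasFDerivAt.restrictScalars ℝ).inner ℂ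
    (hk.hasDerivAt.hasFDerivAt.restrictScalars ℝ)
  rw [dW, h.fderiv]
  simp [inner_smul_left, inner_smul_right]
  linear_combination (-(inner ℂ (f w) (deriv k w)) / 2 + inner ℂ (deriv f w) (k w) / 2)
    * Complex.I_mul_I

/-- The logarithmic derivative `∂ log f = (∂f/∂w) / f`. -/
noncomputable def logDW (f : ℂ → ℂ) (w : ℂ) : ℂ := dW f w / f w

theorem logDW_congr {f g : ℂ → ℂ} {w : ℂ} (h : f =ᶠ[𝓝 w] g) : logDW f w = logDW g w := by
  rw [logDW, logDW, dW_congr h, h.self_of_nhds]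

theorem logDW_mul {f g : ℂ → ℂ} {w : ℂ} (hf : DifferentiableAt ℝ f w)
    (hg : DifferentiableAt ℝ g w) (hf0 : f w ≠ 0) (hg0 : g w ≠ 0) :
    logDW (fun z => f z * g z) w = logDW f w + logDW g w := by
  rw [logDW, logDW, logDW, dW_mul hf hg]
  field_simp

theorem logDW_const_mul {f : ℂ → ℂ} {w c : ℂ} (hf : DifferentiableAt ℝ f w) (hc : c ≠ 0) :
    logDW (fun z => c * f z) w = logDW f w := by
  rw [logDW, logDW, dW_mul (differentiableAt_const c) hf]
  have : dW (fun _ => c) w = 0 := by simp [dW]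
  rw [this, zero_mul, zero_add, mul_div_mul_left _ _ hc]

theorem logDW_inner_self {g : ℂ → ℂ} {w : ℂ} (hg : DifferentiableAt ℂ g w) (hg0 : g w ≠ 0) :
    logDW (fun z => inner ℂ (g z) (g z)) w = deriv g w / g w := by
  have : conj (g w) ≠ 0 := by simpa using hg0
  rw [logDW, dW_inner hg hg]
  simp only [RCLike.inner_apply]
  field_simp

end Wirtinger

/-! ### Curvature as a logarithmic derivative of the Gram determinant -/

section Curvature

variable {H : Type*} [NormedAddCommGroup H] [InnerProductSpace ℂ H]

theorem differentiableAt_gram {n : ℕ} {γ : Fin n → ℂ → H} {w : ℂ}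
    (hγ : ∀ i, DifferentiableAt ℂ (γ i) w) (i j : Fin n) :
    DifferentiableAt ℝ (fun z => gram γ z i j) w :=
  differentiableAt_inner (hγ i) (hγ j)

/-- In rank one the curvature is `-∂̄∂ log h`. -/
theorem curvature_fin_one (t : Fin 1 → ℂ → H) (w : ℂ) :
    curvature t w 0 0 = -dWbar (logDW fun z => inner ℂ (t 0 z) (t 0 z)) w := by
  simp only [curvature, Matrix.of_apply]
  congr 2
  funext z
  simp [Matrix.mul_apply, logDW, gram, div_eq_inv_mul]

variable [CompleteSpace H]

theorem differentiableAt_deriv_of_isOpen {U : Set ℂ} (hU : IsOpen U) {f : ℂ → H}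
    (hf : DifferentiableOn ℂ f U) {w : ℂ} (hw : w ∈ U) : DifferentiableAt ℂ (deriv f) w :=
  (hf.deriv hU).differentiableAt (hU.mem_nhds hw)

theorem differentiableAt_dW_gram {n : ℕ} {U : Set ℂ} (hU : IsOpen U) {γ : Fin n → ℂ → H}
    (hγ : ∀ i, DifferentiableOn ℂ (γ i) U) {w : ℂ} (hw : w ∈ U) (i j : Fin n) :
    DifferentiableAt ℝ (dW fun z => gram γ z i j) w := by
  have h : (dW fun z => gram γ z i j) =ᶠ[𝓝 w] fun z => inner ℂ (γ i z) (deriv (γ j) z) := by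
    filter_upwards [hU.mem_nhds hw] with z hz
    exact dW_inner ((hγ i).differentiableAt (hU.mem_nhds hz))
      ((hγ j).differentiableAt (hU.mem_nhds hz))
  rw [h.differentiableAt_iff]
  exact differentiableAt_inner ((hγ i).differentiableAt (hU.mem_nhds hw))
    (differentiableAt_deriv_of_isOpen hU (hγ j) hw)

theorem differentiableAt_logDW_inner_self {U : Set ℂ} (hU : IsOpen U) {t : ℂ → H}
    (ht : DifferentiableOn ℂ t U) {w : ℂ} (hw : w ∈ U) (h0 : t w ≠ 0) :
    DifferentiableAt ℝ (logDW fun z => inner ℂ (t z) (t z)) w := by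
  have h := differentiableAt_deriv_of_isOpen hU ht hw
  have ht' := ht.differentiableAt (hU.mem_nhds hw)
  have heq : (logDW fun z => inner ℂ (t z) (t z))
      =ᶠ[𝓝 w] fun z => inner ℂ (t z) (deriv t z) * (inner ℂ (t z) (t z))⁻¹ := by
    filter_upwards [hU.mem_nhds hw] with z hz
    have hz' := ht.differentiableAt (hU.mem_nhds hz)
    rw [logDW, dW_inner hz' hz', div_eq_mul_inv]
  rw [heq.differentiableAt_iff]
  exact (differentiableAt_inner ht' h).fun_mul
    ((differentiableAt_inner ht' ht').fun_inv (inner_self_ne_zero.2 h0))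

/-- In rank two the trace of the curvature is `-∂̄∂ log det h`. -/
theorem trace_curvature_fin_two {U : Set ℂ} (hU : IsOpen U) {γ : Fin 2 → ℂ → H}
    (hγ : ∀ i, DifferentiableOn ℂ (γ i) U) (hdet : ∀ z ∈ U, (gram γ z).det ≠ 0) {w : ℂ}
    (hw : w ∈ U) : (curvature γ w).trace = -dWbar (logDW fun z => (gram γ z).det) w := by
  have hg : ∀ z ∈ U, ∀ i j, DifferentiableAt ℝ (fun z => gram γ z i j) z := fun z hz =>
    differentiableAt_gram fun i => (hγ i).differentiableAt (hU.mem_nhds hz)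
  have hg' := differentiableAt_dW_gram hU hγ hw
  have hd : DifferentiableAt ℝ (fun z => (gram γ z).det⁻¹) w := by
    refine DifferentiableAt.fun_inv ?_ (hdet w hw)
    simp only [Matrix.det_fin_two]
    exact ((hg w hw 0 0).fun_mul (hg w hw 1 1)).fun_sub ((hg w hw 0 1).fun_mul (hg w hw 1 0))
  rw [Matrix.trace_fin_two]
  simp only [curvature, Matrix.of_apply]
  have e0 : ∀ z, ((gram γ z)⁻¹ * Matrix.of fun k l => dW (fun ζ => gram γ ζ k l) z) 0 0
      = (gram γ z).det⁻¹ * (gram γ z 1 1 * dW (fun ζ => gram γ ζ 0 0) z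
        - gram γ z 0 1 * dW (fun ζ => gram γ ζ 1 0) z) := fun z => by
    simp [Matrix.mul_apply, Matrix.inv_def, Matrix.adjugate_fin_two, Fin.sum_univ_two]
    ring
  have e1 : ∀ z, ((gram γ z)⁻¹ * Matrix.of fun k l => dW (fun ζ => gram γ ζ k l) z) 1 1
      = (gram γ z).det⁻¹ * (gram γ z 0 0 * dW (fun ζ => gram γ ζ 1 1) z
        - gram γ z 1 0 * dW (fun ζ => gram γ ζ 0 1) z) := fun z => by
    simp [Matrix.mul_apply, Matrix.inv_def, Matrix.adjugate_fin_two, Fin.sum_univ_two]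
    ring
  simp only [e0, e1]
  rw [← neg_add, ← dWbar_add]
  · congr 1
    refine dWbar_congr ?_
    filter_upwards [hU.mem_nhds hw] with z hz
    simp only [logDW, Matrix.det_fin_two]
    rw [dW_sub ((hg z hz 0 0).fun_mul (hg z hz 1 1)) ((hg z hz 0 1).fun_mul (hg z hz 1 0)),
      dW_mul (hg z hz 0 0) (hg z hz 1 1), dW_mul (hg z hz 0 1) (hg z hz 1 0)]
    ring
  · exact hd.fun_mul (((hg w hw 1 1).fun_mul (hg' 0 0)).fun_sub ((hg w hw 0 1).fun_mul (hg' 1 0)))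
  · exact hd.fun_mul (((hg w hw 0 0).fun_mul (hg' 1 1)).fun_sub ((hg w hw 1 0).fun_mul (hg' 0 1)))

end Curvature

/-! ### Holomorphic frames and their Gram determinants -/

section Frames

variable {H : Type*} [NormedAddCommGroup H] [InnerProductSpace ℂ H]

theorem IsHolomorphicFrame.apply_eq {n : ℕ} {T : H →L[ℂ] H} {U : Set ℂ} {γ : Fin n → ℂ → H}
    (h : IsHolomorphicFrame T U γ) {z : ℂ} (hz : z ∈ U) (i : Fin n) : T (γ i z) = z • γ i z := by
  rw [← mem_eigenspace, ← h.span_eq z hz]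
  exact Submodule.subset_span ⟨i, rfl⟩

theorem IsHolomorphicFrame.ne_zero {n : ℕ} {T : H →L[ℂ] H} {U : Set ℂ} {γ : Fin n → ℂ → H}
    (h : IsHolomorphicFrame T U γ) {z : ℂ} (hz : z ∈ U) (i : Fin n) : γ i z ≠ 0 :=
  (h.linearIndependent z hz).ne_zero i

theorem IsCowenDouglas.isHolomorphicFrame {Ω U : Set ℂ} {T : H →L[ℂ] H}
    (hT : IsCowenDouglas 1 Ω T) (hU : U ⊆ Ω) {t : ℂ → H} (ht : DifferentiableOn ℂ t U)
    (h : ∀ w ∈ U, T (t w) = w • t w ∧ t w ≠ 0) :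
    IsHolomorphicFrame T U (fun _ : Fin 1 => t) where
  holomorphic _ := ht
  linearIndependent w hw := by
    rw [linearIndependent_unique_iff]; exact (h w hw).2
  span_eq w hw := by
    rw [Set.range_const]
    ext x
    rw [Submodule.mem_span_singleton, mem_eigenspace]
    constructor
    · rintro ⟨c, rfl⟩
      rw [map_smul, (h w hw).1, smul_comm]
    · intro hx
      obtain ⟨c, rfl⟩ := hT.exists_smul (hU hw) (h w hw).1 (h w hw).2 hx
      exact ⟨c, rfl⟩

/-- The coefficient of a holomorphic section of a line spanned by a nowhere vanishing holomorphic
section is holomorphic: near `z₀` it is `⟨t(z₀), y(z)⟩ / ⟨t(z₀), t(z)⟩`. -/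
theorem exists_holomorphic_coefficient {U : Set ℂ} (hU : IsOpen U) {t y : ℂ → H}
    (ht : DifferentiableOn ℂ t U) (hy : DifferentiableOn ℂ y U) (h0 : ∀ z ∈ U, t z ≠ 0)
    (h : ∀ z ∈ U, ∃ c : ℂ, y z = c • t z) :
    ∃ b : ℂ → ℂ, DifferentiableOn ℂ b U ∧ ∀ z ∈ U, y z = b z • t z := by
  classical
  choose! b hb using h
  refine ⟨b, fun z₀ hz₀ => DifferentiableAt.differentiableWithinAt ?_, hb⟩
  have hU₀ := hU.mem_nhds hz₀
  have ht₀ := ht.differentiableAt hU₀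
  have d1 : DifferentiableAt ℂ (fun z => innerSL ℂ (t z₀) (t z)) z₀ :=
    (innerSL ℂ (t z₀)).differentiableAt.comp z₀ ht₀
  have d2 : DifferentiableAt ℂ (fun z => innerSL ℂ (t z₀) (y z)) z₀ :=
    (innerSL ℂ (t z₀)).differentiableAt.comp z₀ (hy.differentiableAt hU₀)
  have hne : innerSL ℂ (t z₀) (t z₀) ≠ 0 := inner_self_ne_zero.2 (h0 z₀ hz₀)
  have heq : b =ᶠ[𝓝 z₀] fun z => innerSL ℂ (t z₀) (y z) / innerSL ℂ (t z₀) (t z) := by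
    filter_upwards [hU₀, d1.continuousAt.eventually_ne hne] with z hz hz'
    rw [hb z hz, map_smul, smul_eq_mul, mul_div_cancel_right₀ _ hz']
  rw [heq.differentiableAt_iff]
  exact d2.fun_div d1 hne

/-- Differentiating `T t(z) = z t(z)`. -/
theorem apply_deriv_eq {T : H →L[ℂ] H} {U : Set ℂ} (hU : IsOpen U) {t : ℂ → H}
    (ht : DifferentiableOn ℂ t U) (h : ∀ z ∈ U, T (t z) = z • t z) {z : ℂ} (hz : z ∈ U) :
    T (deriv t z) = z • deriv t z + t z := by
  have h1 := (ht.differentiableAt (hU.mem_nhds hz)).hasDerivAt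
  have h2 : HasDerivAt (fun z => T (t z)) (T (deriv t z)) z := T.hasFDerivAt.comp_hasDerivAt z h1
  have h3 : HasDerivAt (fun z => z • t z) (z • deriv t z + (1 : ℂ) • t z) z :=
    (hasDerivAt_id z).smul h1
  have heq : (fun z => T (t z)) =ᶠ[𝓝 z] fun z => z • t z := by
    filter_upwards [hU.mem_nhds hz] with y hy using h y hy
  simpa using h2.unique (h3.congr_of_eventuallyEq heq)

variable {H₀ H₁ : Type*} [NormedAddCommGroup H₀] [InnerProductSpace ℂ H₀]
  [NormedAddCommGroup H₁] [InnerProductSpace ℂ H₁]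
  {T₀ : H₀ →L[ℂ] H₀} {S : H₁ →L[ℂ] H₀} {T₁ : H₁ →L[ℂ] H₁}

theorem IsFB₂.exists_intertwining_coefficient (hT : IsFB₂ disc T₀ S T₁) {U : Set ℂ}
    (hU : IsOpen U) (hUd : U ⊆ disc) {t₀ : ℂ → H₀} {t₁ : ℂ → H₁} (ht₀ : DifferentiableOn ℂ t₀ U)
    (ht₁ : DifferentiableOn ℂ t₁ U) (h₀ : ∀ z ∈ U, T₀ (t₀ z) = z • t₀ z ∧ t₀ z ≠ 0)
    (h₁ : ∀ z ∈ U, T₁ (t₁ z) = z • t₁ z) :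
    ∃ f : ℂ → ℂ, DifferentiableOn ℂ f U ∧ ∀ z ∈ U, S (t₁ z) = f z • t₀ z :=
  exists_holomorphic_coefficient hU ht₀ (S.differentiable.comp_differentiableOn ht₁)
    (fun z hz => (h₀ z hz).2) fun z hz =>
      hT.left.exists_smul (hUd hz) (h₀ z hz).1 (h₀ z hz).2 (hT.map_eigenvector (h₁ z hz))

variable [CompleteSpace H₀]

/-- With `S t₁ = f t₀`, the sections `(t₀, 0)` and `(f t₀', -t₁)` form a holomorphic frame of the
eigenvector bundle of `T`. -/
theorem IsFB₂.isHolomorphicFrame (hT : IsFB₂ disc T₀ S T₁) {U : Set ℂ}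
    (hU : IsOpen U) (hUd : U ⊆ disc) {t₀ : ℂ → H₀} {t₁ : ℂ → H₁} (ht₀ : DifferentiableOn ℂ t₀ U)
    (ht₁ : DifferentiableOn ℂ t₁ U) (h₀ : ∀ z ∈ U, T₀ (t₀ z) = z • t₀ z ∧ t₀ z ≠ 0)
    (h₁ : ∀ z ∈ U, T₁ (t₁ z) = z • t₁ z ∧ t₁ z ≠ 0) {f : ℂ → ℂ} (hf : DifferentiableOn ℂ f U)
    (hS : ∀ z ∈ U, S (t₁ z) = f z • t₀ z) :
    IsHolomorphicFrame (blockOp T₀ S T₁) U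
      ![fun z => inlL (t₀ z), fun z => inlL (f z • deriv t₀ z) - inrL (t₁ z)] where
  holomorphic i := by
    have h2 := hf.fun_smul (ht₀.deriv hU)
    have d0 : DifferentiableOn ℂ (fun z => (inlL (t₀ z) : WithLp 2 (H₀ × H₁))) U :=
      (inlL (H₁ := H₁)).differentiable.comp_differentiableOn ht₀
    have d1 : DifferentiableOn ℂ (fun z => (inlL (f z • deriv t₀ z) : WithLp 2 (H₀ × H₁))) U :=
      (inlL (H₁ := H₁)).differentiable.comp_differentiableOn h2
    have d2 : DifferentiableOn ℂ (fun z => (inrL (t₁ z) : WithLp 2 (H₀ × H₁))) U :=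
      (inrL (H₀ := H₀)).differentiable.comp_differentiableOn ht₁
    have d3 := d1.fun_sub d2
    fin_cases i
    · exact d0
    · exact d3
  linearIndependent z hz := by
    have hne : (inlL (t₀ z) : WithLp 2 (H₀ × H₁)) ≠ 0 :=
      fun h => (h₀ z hz).2 (congrArg WithLp.fst h)
    have hli : LinearIndependent ℂ ![(inlL (t₀ z) : WithLp 2 (H₀ × H₁)),
        inlL (f z • deriv t₀ z) - inrL (t₁ z)] := by
      rw [LinearIndependent.pair_iff' hne]
      intro c hc
      have := congrArg WithLp.snd hc
      exact (h₁ z hz).2 (by simpa [eq_comm] using this)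
    have hvec : (fun i => (![fun z => inlL (t₀ z), fun z => inlL (f z • deriv t₀ z) - inrL (t₁ z)] :
        Fin 2 → ℂ → WithLp 2 (H₀ × H₁)) i z)
        = ![inlL (t₀ z), inlL (f z • deriv t₀ z) - inrL (t₁ z)] := by
      ext1 i
      fin_cases i <;> rfl
    rw [hvec]
    exact hli
  span_eq z hz := by
    have hd := apply_deriv_eq hU ht₀ (fun z hz => (h₀ z hz).1) hz
    apply le_antisymm
    · rw [Submodule.span_le]
      rintro _ ⟨i, rfl⟩
      rw [SetLike.mem_coe, mem_eigenspace]
      fin_cases i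
      · exact blockOp_inlL (h₀ z hz).1
      · refine ext_prod ?_ ?_
        · simp [blockOp_fst, hd, hS z hz, smul_comm z]
        · simp [blockOp_snd, (h₁ z hz).1]
    · intro x hx
      rw [mem_eigenspace] at hx
      have hx0 : T₀ x.fst + S x.snd = z • x.fst := congrArg WithLp.fst hx
      have hx1 : T₁ x.snd = z • x.snd := congrArg WithLp.snd hx
      obtain ⟨b, hb⟩ := hT.right.exists_smul (hUd hz) (h₁ z hz).1 (h₁ z hz).2 hx1
      obtain ⟨c, hc⟩ := hT.left.exists_smul (hUd hz) (h₀ z hz).1 (h₀ z hz).2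
        (x := x.fst + b • f z • deriv t₀ z) (by
          rw [hb, map_smul, hS z hz] at hx0
          rw [map_add, map_smul, map_smul, hd]
          linear_combination (norm := module) hx0)
      have hxe : x = c • inlL (t₀ z) + (-b) • (inlL (f z • deriv t₀ z) - inrL (t₁ z)) := by
        refine ext_prod ?_ ?_
        · have : x.fst = c • t₀ z - b • f z • deriv t₀ z := by rw [← hc]; abel
          simp [this, sub_eq_add_neg]
        · simp [hb]
      rw [hxe]
      exact Submodule.add_mem _ (Submodule.smul_mem _ _ (Submodule.subset_span ⟨0, rfl⟩))
        (Submodule.smul_mem _ _ (Submodule.subset_span ⟨1, rfl⟩))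

variable [CompleteSpace H₁]

theorem IsFB₂.exists_frames (hT : IsFB₂ disc T₀ S T₁) {w : ℂ} (hw : w ∈ disc) :
    ∃ U : Set ℂ, IsOpen U ∧ w ∈ U ∧ U ⊆ disc ∧
      (∃ γ : Fin 2 → ℂ → WithLp 2 (H₀ × H₁), IsHolomorphicFrame (blockOp T₀ S T₁) U γ) ∧
      (∃ t₀ : Fin 1 → ℂ → H₀, IsHolomorphicFrame T₀ U t₀) ∧
      (∃ t₁ : Fin 1 → ℂ → H₁, IsHolomorphicFrame T₁ U t₁) := by
  obtain ⟨r₀, hr₀, t₀, ht₀, h₀⟩ := hT.left.exists_holomorphic_eigenvector hw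
  obtain ⟨r₁, hr₁, t₁, ht₁, h₁⟩ := hT.right.exists_holomorphic_eigenvector hw
  let U := Metric.ball w r₀ ∩ Metric.ball w r₁ ∩ disc
  have hU : IsOpen U := (Metric.isOpen_ball.inter Metric.isOpen_ball).inter isOpen_disc
  have hUd : U ⊆ disc := Set.inter_subset_right
  have hU₀ : U ⊆ Metric.ball w r₀ := fun z hz => hz.1.1
  have hU₁ : U ⊆ Metric.ball w r₁ := fun z hz => hz.1.2
  have h₀' := fun z hz => h₀ z (hU₀ hz)
  have h₁' := fun z hz => h₁ z (hU₁ hz)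
  obtain ⟨f, hf, hS⟩ := hT.exists_intertwining_coefficient hU hUd (ht₀.mono hU₀) (ht₁.mono hU₁)
    h₀' (fun z hz => (h₁' z hz).1)
  exact ⟨U, hU, ⟨⟨Metric.mem_ball_self hr₀, Metric.mem_ball_self hr₁⟩, hw⟩, hUd,
    ⟨_, hT.isHolomorphicFrame hU hUd (ht₀.mono hU₀) (ht₁.mono hU₁) h₀' h₁' hf hS⟩,
    ⟨_, hT.left.isHolomorphicFrame hUd (ht₀.mono hU₀) h₀'⟩,
    ⟨_, hT.right.isHolomorphicFrame hUd (ht₁.mono hU₁) h₁'⟩⟩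

/-- The Gram determinant of any holomorphic frame of the eigenvector bundle of a homogeneous `T` is
`C |g|² ‖t₀‖² ‖t₁‖²`. Here `g` is the determinant of the holomorphic change of frame from
`(t₀, 0), (f t₀', -t₁)`, whose own Gram determinant is
`‖t₀‖² ‖t₁‖² + |f|² (‖t₀‖² ‖t₀'‖² - |⟨t₀, t₀'⟩|²)`. -/
theorem IsFB₂.exists_det_gram_eq (hT : IsFB₂ disc T₀ S T₁) (hhom : IsHomogeneous (blockOp T₀ S T₁))
    {U : Set ℂ} (hU : IsOpen U) (hUd : U ⊆ disc) {γ : Fin 2 → ℂ → WithLp 2 (H₀ × H₁)}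
    (hγ : IsHolomorphicFrame (blockOp T₀ S T₁) U γ) {t₀ : ℂ → H₀} {t₁ : ℂ → H₁}
    (ht₀ : DifferentiableOn ℂ t₀ U) (ht₁ : DifferentiableOn ℂ t₁ U)
    (h₀ : ∀ z ∈ U, T₀ (t₀ z) = z • t₀ z ∧ t₀ z ≠ 0)
    (h₁ : ∀ z ∈ U, T₁ (t₁ z) = z • t₁ z ∧ t₁ z ≠ 0) :
    ∃ C : ℂ, C ≠ 0 ∧ ∃ g : ℂ → ℂ, DifferentiableOn ℂ g U ∧ (∀ z ∈ U, g z ≠ 0) ∧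
      ∀ z ∈ U, (gram γ z).det = C * (inner ℂ (g z) (g z) *
        (inner ℂ (t₀ z) (t₀ z) * inner ℂ (t₁ z) (t₁ z))) := by
  obtain ⟨f, hf, hS⟩ := hT.exists_intertwining_coefficient hU hUd ht₀ ht₁ h₀
    (fun z hz => (h₁ z hz).1)
  obtain ⟨c, hc0, hc⟩ := hT.exists_invariant hhom
  have hd := fun z hz => apply_deriv_eq hU ht₀ (fun z hz => (h₀ z hz).1) (z := z) hz
  have hfd := hf.fun_smul (ht₀.deriv hU)
  -- the coordinates of `γ i` in the frame `(t₀, 0), (f t₀', -t₁)` are `α i` and `-β i`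
  have hβ : ∀ i, ∃ b : ℂ → ℂ, DifferentiableOn ℂ b U ∧ ∀ z ∈ U, (γ i z).snd = b z • t₁ z :=
    fun i => exists_holomorphic_coefficient hU ht₁
      ((WithLp.sndL 2 ℂ H₀ H₁).differentiable.comp_differentiableOn (hγ.holomorphic i))
      (fun z hz => (h₁ z hz).2) fun z hz => hT.right.exists_smul (hUd hz) (h₁ z hz).1 (h₁ z hz).2
        (congrArg WithLp.snd (hγ.apply_eq hz i))
  choose β hβd hβ using hβ
  have hα : ∀ i, ∃ b : ℂ → ℂ, DifferentiableOn ℂ b U ∧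
      ∀ z ∈ U, (γ i z).fst + β i z • f z • deriv t₀ z = b z • t₀ z :=
    fun i => exists_holomorphic_coefficient hU ht₀
      (((WithLp.fstL 2 ℂ H₀ H₁).differentiable.comp_differentiableOn (hγ.holomorphic i)).add
        ((hβd i).fun_smul hfd))
      (fun z hz => (h₀ z hz).2) fun z hz => hT.left.exists_smul (hUd hz) (h₀ z hz).1 (h₀ z hz).2 (by
        have hx0 : T₀ (γ i z).fst + S (γ i z).snd = z • (γ i z).fst :=
          congrArg WithLp.fst (hγ.apply_eq hz i)
        rw [hβ i z hz, map_smul, hS z hz] at hx0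
        rw [map_add, map_smul, map_smul, hd z hz]
        linear_combination (norm := module) hx0)
  choose α hαd hα using hα
  have hfst : ∀ i, ∀ z ∈ U, (γ i z).fst = α i z • t₀ z - β i z • f z • deriv t₀ z :=
    fun i z hz => by rw [← hα i z hz]; abel
  refine ⟨1 + c, by exact_mod_cast (by positivity : (1 + c : ℝ) ≠ 0),
    fun z => α 0 z * β 1 z - α 1 z * β 0 z,
    ((hαd 0).fun_mul (hβd 1)).fun_sub ((hαd 1).fun_mul (hβd 0)), fun z hz hg => ?_, fun z hz => ?_⟩
  · -- if `g z = 0`, two relations between `γ 0 z` and `γ 1 z` force all coordinates to vanish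
    have hli := hγ.linearIndependent z hz
    have hvec : (fun i => γ i z) = ![γ 0 z, γ 1 z] := by
      ext1 i
      fin_cases i <;> rfl
    rw [hvec] at hli
    have hpair := LinearIndependent.pair_iff.1 hli
    have e1 := hpair (β 1 z) (-β 0 z) (ext_prod
      (by
        simp only [WithLp.add_fst, WithLp.smul_fst, WithLp.zero_fst, hfst _ z hz]
        have : α 0 z * β 1 z = α 1 z * β 0 z := sub_eq_zero.1 hg
        have h2 : (α 0 z * β 1 z) • t₀ z = (α 1 z * β 0 z) • t₀ z := by rw [this]
        linear_combination (norm := module) h2)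
      (by
        simp only [WithLp.add_snd, WithLp.smul_snd, WithLp.zero_snd, hβ _ z hz]
        module))
    have hb : ∀ i, β i z = 0 := by
      intro i; fin_cases i
      · exact neg_eq_zero.1 e1.2
      · exact e1.1
    have e2 := hpair (α 1 z) (-α 0 z) (ext_prod
      (by
        simp only [WithLp.add_fst, WithLp.smul_fst, WithLp.zero_fst, hfst _ z hz, hb]
        module)
      (by simp [hβ _ z hz, hb]))
    refine hγ.ne_zero hz 1 (ext_prod ?_ ?_)
    · simp [hfst _ z hz, hb, e2.1]
    · simp [hβ _ z hz, hb]
  · have hinv := hc z (hUd hz) (t₀ z) (deriv t₀ z) (t₁ z) (h₀ z hz).1 (hd z hz) (h₁ z hz).1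
    have hsym : inner ℂ (deriv t₀ z) (t₀ z) = conj (inner ℂ (t₀ z) (deriv t₀ z)) :=
      (inner_conj_symm _ _).symm
    have hA0 : (inner ℂ (t₀ z) (t₀ z) : ℂ) ≠ 0 := inner_self_ne_zero.2 (h₀ z hz).2
    have hinv' : (inner ℂ (t₀ z) (t₀ z) * inner ℂ (deriv t₀ z) (deriv t₀ z)
        - conj (inner ℂ (t₀ z) (deriv t₀ z)) * inner ℂ (t₀ z) (deriv t₀ z)) * (conj (f z) * f z)
        = c * inner ℂ (t₀ z) (t₀ z) * inner ℂ (t₁ z) (t₁ z) := by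
      refine mul_right_cancel₀ hA0 ?_
      have h1 := congrArg (fun x : ℝ => (x : ℂ)) hinv
      rw [hS z hz, norm_smul] at h1
      push_cast at h1
      simp only [Complex.conj_mul', inner_self_eq_norm_sq_to_K]
      simp only [Complex.coe_algebraMap]
      linear_combination h1
    have hent : ∀ i j, gram γ z i j
        = conj (α i z) * α j z * inner ℂ (t₀ z) (t₀ z)
          - conj (α i z) * β j z * f z * inner ℂ (t₀ z) (deriv t₀ z)
          - conj (β i z) * α j z * conj (f z) * conj (inner ℂ (t₀ z) (deriv t₀ z))
          + conj (β i z) * β j z * (conj (f z) * f z) * inner ℂ (deriv t₀ z) (deriv t₀ z)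
          + conj (β i z) * β j z * inner ℂ (t₁ z) (t₁ z) := by
      intro i j
      have : gram γ z i j = inner ℂ (γ i z).fst (γ j z).fst + inner ℂ (γ i z).snd (γ j z).snd :=
        WithLp.prod_inner_apply _ _
      rw [this, hfst i z hz, hfst j z hz, hβ i z hz, hβ j z hz]
      simp only [inner_sub_left, inner_sub_right, inner_smul_left, inner_smul_right, hsym]
      ring
    rw [Matrix.det_fin_two, hent, hent, hent, hent]
    simp only [RCLike.inner_apply, map_sub, map_mul]
    linear_combination (conj (α 0 z) * conj (β 1 z) - conj (α 1 z) * conj (β 0 z))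
      * (α 0 z * β 1 z - α 1 z * β 0 z) * hinv'

/-- Since `det h = C |g|² ‖t₀‖² ‖t₁‖²`, applying `∂ log` turns the product into a sum whose first
term `g' / g` is holomorphic, and so is killed by `∂̄`. -/
theorem IsFB₂.trace_curvature (hT : IsFB₂ disc T₀ S T₁) (hhom : IsHomogeneous (blockOp T₀ S T₁))
    {U : Set ℂ} (hU : IsOpen U) (hUd : U ⊆ disc) {γ : Fin 2 → ℂ → WithLp 2 (H₀ × H₁)}
    {t₀ : Fin 1 → ℂ → H₀} {t₁ : Fin 1 → ℂ → H₁}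
    (hγ : IsHolomorphicFrame (blockOp T₀ S T₁) U γ) (h₀ : IsHolomorphicFrame T₀ U t₀)
    (h₁ : IsHolomorphicFrame T₁ U t₁) {w : ℂ} (hw : w ∈ U) :
    (curvature γ w).trace = curvature t₀ w 0 0 + curvature t₁ w 0 0 := by
  have e₀ := fun z hz => And.intro (h₀.apply_eq (z := z) hz 0) (h₀.ne_zero hz 0)
  have e₁ := fun z hz => And.intro (h₁.apply_eq (z := z) hz 0) (h₁.ne_zero hz 0)
  have d₀ := h₀.holomorphic 0
  have d₁ := h₁.holomorphic 0
  obtain ⟨C, hC, g, hg, hg0, hdet⟩ := hT.exists_det_gram_eq hhom hU hUd hγ d₀ d₁ e₀ e₁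
  have n₀ : ∀ z ∈ U, (inner ℂ (t₀ 0 z) (t₀ 0 z) : ℂ) ≠ 0 :=
    fun z hz => inner_self_ne_zero.2 (e₀ z hz).2
  have n₁ : ∀ z ∈ U, (inner ℂ (t₁ 0 z) (t₁ 0 z) : ℂ) ≠ 0 :=
    fun z hz => inner_self_ne_zero.2 (e₁ z hz).2
  have ng : ∀ z ∈ U, (inner ℂ (g z) (g z) : ℂ) ≠ 0 := fun z hz => inner_self_ne_zero.2 (hg0 z hz)
  have hdet0 : ∀ z ∈ U, (gram γ z).det ≠ 0 := fun z hz => by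
    rw [hdet z hz]
    exact mul_ne_zero hC (mul_ne_zero (ng z hz) (mul_ne_zero (n₀ z hz) (n₁ z hz)))
  rw [trace_curvature_fin_two hU hγ.holomorphic hdet0 hw,
    curvature_fin_one, curvature_fin_one]
  have hlog : (logDW fun z => (gram γ z).det) =ᶠ[nhds w] fun z =>
      deriv g z / g z + (logDW (fun z => inner ℂ (t₀ 0 z) (t₀ 0 z)) z
        + logDW (fun z => inner ℂ (t₁ 0 z) (t₁ 0 z)) z) := by
    filter_upwards [hU.mem_nhds hw] with z hz
    have hUz := hU.mem_nhds hz
    have hgz := hg.differentiableAt hUz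
    have rg := differentiableAt_inner hgz hgz
    have r₀ := differentiableAt_inner (d₀.differentiableAt hUz)
      (d₀.differentiableAt hUz)
    have r₁ := differentiableAt_inner (d₁.differentiableAt hUz)
      (d₁.differentiableAt hUz)
    rw [logDW_congr (g := fun z => C * (inner ℂ (g z) (g z) *
        (inner ℂ (t₀ 0 z) (t₀ 0 z) * inner ℂ (t₁ 0 z) (t₁ 0 z))))
        (Filter.eventually_of_mem hUz hdet),
      logDW_const_mul (rg.fun_mul (r₀.fun_mul r₁)) hC,
      logDW_mul rg (r₀.fun_mul r₁) (ng z hz) (mul_ne_zero (n₀ z hz) (n₁ z hz)),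
      logDW_mul r₀ r₁ (n₀ z hz) (n₁ z hz),
      logDW_inner_self hgz (hg0 z hz)]
  have hgw : DifferentiableAt ℂ (fun z => deriv g z / g z) w :=
    (differentiableAt_deriv_of_isOpen hU hg hw).fun_div
      (hg.differentiableAt (hU.mem_nhds hw)) (hg0 w hw)
  have l₀ := differentiableAt_logDW_inner_self hU d₀ hw (e₀ w hw).2
  have l₁ := differentiableAt_logDW_inner_self hU d₁ hw (e₁ w hw).2
  rw [dWbar_congr hlog,
    dWbar_add (hgw.restrictScalars ℝ) (l₀.fun_add l₁),
    dWbar_eq_zero hgw, dWbar_add l₀ l₁]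
  ring

end Frames

end CowenDouglas

theorem proposition1p6 {H₀ H₁ : Type*}
    [NormedAddCommGroup H₀] [InnerProductSpace ℂ H₀] [CompleteSpace H₀]
    [TopologicalSpace.SeparableSpace H₀]
    [NormedAddCommGroup H₁] [InnerProductSpace ℂ H₁] [CompleteSpace H₁]
    [TopologicalSpace.SeparableSpace H₁]
    (T₀ : H₀ →L[ℂ] H₀) (S : H₁ →L[ℂ] H₀) (T₁ : H₁ →L[ℂ] H₁)
    (hT : CowenDouglas.IsFB₂ CowenDouglas.disc T₀ S T₁)
    (hhom : CowenDouglas.IsHomogeneous (CowenDouglas.blockOp T₀ S T₁)) :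
    -- the three eigenvector bundles have holomorphic frames near every point of the disc
    (∀ w ∈ CowenDouglas.disc, ∃ U : Set ℂ, IsOpen U ∧ w ∈ U ∧ U ⊆ CowenDouglas.disc ∧
      (∃ γ : Fin 2 → ℂ → WithLp 2 (H₀ × H₁),
        CowenDouglas.IsHolomorphicFrame (CowenDouglas.blockOp T₀ S T₁) U γ) ∧
      (∃ t₀ : Fin 1 → ℂ → H₀, CowenDouglas.IsHolomorphicFrame T₀ U t₀) ∧
      (∃ t₁ : Fin 1 → ℂ → H₁, CowenDouglas.IsHolomorphicFrame T₁ U t₁)) ∧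
    -- and the trace formula holds at every point, whichever frames compute the curvatures
    (∀ U : Set ℂ, IsOpen U → U ⊆ CowenDouglas.disc →
      ∀ (γ : Fin 2 → ℂ → WithLp 2 (H₀ × H₁)) (t₀ : Fin 1 → ℂ → H₀) (t₁ : Fin 1 → ℂ → H₁),
        CowenDouglas.IsHolomorphicFrame (CowenDouglas.blockOp T₀ S T₁) U γ →
        CowenDouglas.IsHolomorphicFrame T₀ U t₀ →
        CowenDouglas.IsHolomorphicFrame T₁ U t₁ →
        ∀ w ∈ U, (CowenDouglas.curvature γ w).trace =
          CowenDouglas.curvature t₀ w 0 0 + CowenDouglas.curvature t₁ w 0 0) :=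
  ⟨fun _ hw => hT.exists_frames hw, fun _ hU hUd _ _ _ hγ h₀ h₁ _ hw =>
    hT.trace_curvature hhom hU hUd hγ h₀ h₁ hw⟩
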